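/- Let $v,d\in\mathbb{R}^n$ with $v\ge 0$, $v\neq 0$ and no index $i$ with $v_i=d_i=0$; put $V=\operatorname{diag}(v)$, $D=\operatorname{diag}(d)$. Let $Q\in\mathbb{R}^{n\times n}$ be an irreducible rate matrix ($Q_{ij}\ge0$ for $i\ne j$, $Q\mathbf 1=0$), with left Perron vector $u>0$, $uQ=0$. Let $P(z)=Vz^2-Dz+Q$. Let $E_1=\{v_i>0\}$, $E_2=\{v_i=0,\ d_i>0\}$, $E_3=\{v_i=0,\ d_i<0\}$, let the states be ordered as $E_1,E_2,E_3$, and let $n_3=|E_3|$. Write $V_1$ for the $E_1$-block of $V$, and $D_a$, $Q_{ab}$ for the blocks of $D$ and $Q$ indexed by $E_a$, $E_a\times E_b$. Let $h>0$ be so small that $h^{-2}v_i+h^{-1}d_i+Q_{ii}\ge 0$ for $i\in E_1\cup E_2$, and let $\widetilde F(y)=\widetilde Ay^2-\widetilde By+\widetilde C$ with $$\widetilde A=\begin{bmatrix}h^{-2}V_1&0&0\\0&0&0\\0&0&-h^{-1}D_3\end{bmatrix},\quad \widetilde B=\begin{bmatrix}2h^{-2}V_1+h^{-1}D_1&0&-Q_{13}\\0&h^{-1}D_2&-Q_{23}\\0&0&-h^{-1}D_3-Q_{33}\end{bmatrix},\quad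 \widetilde C=\begin{bmatrix}h^{-2}V_1+h^{-1}D_1+Q_{11}&Q_{12}&0\\Q_{21}&h^{-1}D_2+Q_{22}&0\\Q_{31}&Q_{32}&0\end{bmatrix}.$$ Cyclic Reduction starts from $A_0=\widetilde A$, $B_0=\widehat B_0=\widetilde B$, $C_0=\widetilde C$ and iterates $$A_{j+1}=A_jB_j^{-1}A_j,\quad B_{j+1}=B_j-A_jB_j^{-1}C_j-C_jB_j^{-1}A_j,\quad C_{j+1}=C_jB_j^{-1}C_j,\quad \widehat B_{j+1}=\widehat B_j-C_jB_j^{-1}A_j.$$ Definitions. A left invariant pair of $M_2z^2+M_1z+M_0$ is a pair $(X,U)$ with $UM_0+XUM_1+X^2UM_2=0$ such that $[\,U\ \ XU\,]$ has full row rank; its eigenvalues are those of $X$. All eigenvalues are counted with multiplicity; those of a matrix polynomial are the roots of its determinant. A left invariant pair of $P$ is c-stable if its eigenvalues are exactly the eigenvalues of $P$ with negative real part, together with one eigenvalue $0$ unless $uD\mathbf 1<0$. The d-stable eigenvalues of $\widetilde F$ are its eigenvalues of modulus less than $1$, together with one eigenvalue $1$ unless $w(\widetilde C-\widetilde A)\mathbf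 1<0$, where $w>0$ is the left Perron vector of $\widetilde A-\widetilde B+\widetilde C$. An arithmetic expression with constants $0,1$ and the operations negation, addition, multiplication and division is subtraction-free at given values of its variables if its evaluation never adds two numbers of strictly opposite sign (that is, never subtracts two numbers of the same sign) and never divides by $0$. Theorem. All $B_j$ are nonsingular, and the limits $\widehat B_\infty=\lim_j\widehat B_j$ and $\hat v=\lim_j uA_j$ exist. Partition $$C_0=\begin{bmatrix}C_{11}&0\\C_{21}&0\end{bmatrix},\qquad \widehat B_\infty=\begin{bmatrix}B_{11}&B_{12}\\B_{21}&B_{22}\end{bmatrix},$$ where the bottom right block, of size $n_3\times n_3$, corresponds to $E_3$. Then $B_{22}$ and $S=B_{11}+\Psi B_{21}$ are nonsingular, where $\Psi=-B_{12}B_{22}^{-1}\ge0$, and $Y=(C_{11}+\Psi C_{21})S^{-1}\ge 0$. Moreover: 1. $\widetilde F$ is regular, and $(Y,[\,I\ \ \Psi\,])$ is a left invariant pair of $\widetilde F(y)$ whose eigenvalues, together with $n_3$ eigenvalues equal to $0$, are exactly the d-stable eigenvalues of $\widetilde F$ (so the pair is d-stable after the deflation of the $n_3$ zero eigenvalues).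 2. $P$ is regular, and with $X=h^{-1}(Y-I)$ the pair $(X,[\,I\ \ \Psi\,])$ is a c-stable left invariant pair of $P(z)$. 3. For fixed sizes $|E_1\cup E_2|$ and $|E_3|$, the entries of $\Psi$, $Y$ and $X$ are given by fixed arithmetic expressions, independent of $v,d,Q,u,h$, in the off-diagonal entries of $\widehat B_\infty$, the entries of $C_0$, $u$ and $\hat v$, and $h$; these expressions are subtraction-free at all data as above. -/

import Mathlib

open Filter Topology Matrix

noncomputable section

namespace MMBM

/-! ## Quadratic matrix polynomials, eigenvalues, left invariant pairs -/

section Pencil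

variable {ι l : Type*} [Fintype ι] [DecidableEq ι] [Fintype l] [DecidableEq l]

/-- The real matrix polynomial `P₂ z² + P₁ z + P₀`, with coefficients regarded as complex. -/
def quadPoly (P₂ P₁ P₀ : Matrix ι ι ℝ) : Matrix ι ι (Polynomial ℂ) :=
  Matrix.of fun i j =>
    Polynomial.C (P₂ i j : ℂ) * Polynomial.X ^ 2 + Polynomial.C (P₁ i j : ℂ) * Polynomial.X
      + Polynomial.C (P₀ i j : ℂ)

/-- The matrix polynomial is regular: its determinant is not the zero polynomial. -/
def IsRegular (P₂ P₁ P₀ : Matrix ι ι ℝ) : Prop := (quadPoly P₂ P₁ P₀).det ≠ 0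

/-- The finite eigenvalues of the matrix polynomial, counted with algebraic multiplicity. -/
def eigs (P₂ P₁ P₀ : Matrix ι ι ℝ) : Multiset ℂ := (quadPoly P₂ P₁ P₀).det.roots

/-- The complex eigenvalues of a square real matrix, counted with algebraic multiplicity. -/
def matEigs (X : Matrix l l ℝ) : Multiset ℂ := (X.map (algebraMap ℝ ℂ)).charpoly.roots

/-- `(X, U)` is a left invariant pair of `P₂ z² + P₁ z + P₀`:
`U P₀ + X U P₁ + X² U P₂ = 0`, and `[U  XU]` has full row rank. -/
def IsLeftInvariantPair (P₂ P₁ P₀ : Matrix ι ι ℝ) (X : Matrix l l ℝ) (U : Matrix l ι ℝ) : Prop :=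
  U * P₀ + X * U * P₁ + X ^ 2 * U * P₂ = 0 ∧
    (Matrix.fromCols U (X * U)).rank = Fintype.card l

end Pencil

/-! ## Stability in continuous time, for `P(z) = V z² - D z + Q` -/

section Continuous

variable {ι l : Type*} [Fintype ι] [DecidableEq ι] [Fintype l] [DecidableEq l]

/-- Negative mean drift `u D 1 < 0`, with `u` the (positive) left Perron vector of `Q`. -/
def CPositiveRecurrent (D Q : Matrix ι ι ℝ) : Prop :=
  ∃ u : ι → ℝ, (∀ i, 0 < u i) ∧ u ᵥ* Q = 0 ∧ u ⬝ᵥ (D *ᵥ 1) < 0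

open Classical in
/-- The eigenvalues of `V z² - D z + Q` in the open left half-plane, and in addition one
eigenvalue `0` unless the mean drift is negative. -/
def cStableEigs (V D Q : Matrix ι ι ℝ) : Multiset ℂ :=
  (eigs V (-D) Q).filter (fun z => z.re < 0) + (if CPositiveRecurrent D Q then 0 else {0})

/-- `(X, U)` is a c-stable left invariant pair of the regular polynomial `V z² - D z + Q`. -/
def IsCStablePair (V D Q : Matrix ι ι ℝ) (X : Matrix l l ℝ) (U : Matrix l ι ℝ) : Prop :=
  IsRegular V (-D) Q ∧ IsLeftInvariantPair V (-D) Q X U ∧ matEigs X = cStableEigs V D Q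

end Continuous

/-! ## Stability in discrete time, for `F(y) = A y² - B y + C` -/

section Discrete

variable {ι l : Type*} [Fintype ι] [DecidableEq ι] [Fintype l] [DecidableEq l]

/-- Negative mean drift `u (C - A) 1 < 0`, with `u` the (positive) left Perron vector of
`A - B + C`. -/
def DPositiveRecurrent (A B C : Matrix ι ι ℝ) : Prop :=
  ∃ u : ι → ℝ, (∀ i, 0 < u i) ∧ u ᵥ* (A - B + C) = 0 ∧ u ⬝ᵥ ((C - A) *ᵥ 1) < 0

open Classical in
/-- The eigenvalues of `A y² - B y + C` in the open unit disc, and in addition one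
eigenvalue `1` unless the mean drift is negative. -/
def dStableEigs (A B C : Matrix ι ι ℝ) : Multiset ℂ :=
  (eigs A (-B) C).filter (fun y => ‖y‖ < 1) + (if DPositiveRecurrent A B C then 0 else {1})

/-- `(Y, U)` is a left invariant pair of the regular polynomial `A y² - B y + C`, whose
eigenvalues are the d-stable ones, after deflating `r` eigenvalues equal to zero.
For `r = 0` this says that `(Y, U)` is a d-stable left invariant pair. -/
def IsDStablePairDeflating (r : ℕ) (A B C : Matrix ι ι ℝ)
    (Y : Matrix l l ℝ) (U : Matrix l ι ℝ) : Prop :=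
  IsRegular A (-B) C ∧ IsLeftInvariantPair A (-B) C Y U ∧
    matEigs Y + Multiset.replicate r 0 = dStableEigs A B C

end Discrete

/-! ## Cyclic Reduction -/

section CyclicReduction

variable {ι : Type*} [Fintype ι] [DecidableEq ι]

/-- The four matrices of one iterate of Cyclic Reduction. -/
structure CRState (ι : Type*) where
  A : Matrix ι ι ℝ
  B : Matrix ι ι ℝ
  C : Matrix ι ι ℝ
  Bhat : Matrix ι ι ℝ

/-- One step of Cyclic Reduction. -/
def crStep (s : CRState ι) : CRState ι where
  A := s.A * s.B⁻¹ * s.A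
  B := s.B - s.A * s.B⁻¹ * s.C - s.C * s.B⁻¹ * s.A
  C := s.C * s.B⁻¹ * s.C
  Bhat := s.Bhat - s.C * s.B⁻¹ * s.A

/-- The iterates of Cyclic Reduction started from `A, B, C` (and `B̂₀ = B`). -/
def cr (A B C : Matrix ι ι ℝ) : ℕ → CRState ι
  | 0 => ⟨A, B, C, B⟩
  | n + 1 => crStep (cr A B C n)

end CyclicReduction

/-! ## The model and the shifted, discretized polynomial -/

section Model

/-- Standing assumptions: variances `v ≥ 0`, not all zero, no state with `v = d = 0`, and an
irreducible rate matrix `Q`. -/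
structure IsModel {ι : Type*} [Fintype ι] (v d : ι → ℝ) (Q : Matrix ι ι ℝ) : Prop where
  v_nonneg : ∀ i, 0 ≤ v i
  v_ne_zero : ∃ i, v i ≠ 0
  no_trivial_state : ∀ i, ¬ (v i = 0 ∧ d i = 0)
  offdiag_nonneg : ∀ i j, i ≠ j → 0 ≤ Q i j
  row_sum : Q *ᵥ 1 = 0
  irreducible : ∀ i j, Relation.ReflTransGen (fun a b => Q a b ≠ 0) i j

variable {m k : Type*} [Fintype m] [Fintype k] [DecidableEq m] [DecidableEq k]

/-! The index set is `m ⊕ k`, where `m` is the set `E₁ ∪ E₂` (`v > 0`, or `v = 0` and `d > 0`)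
and `k` is the set `E₃` (`v = 0` and `d < 0`). On `E₂` the entries of `v` below vanish. -/

/-- `Ã = diag(h⁻² V₁, 0, -h⁻¹ D₃)`. -/
def tildeA (v d : m ⊕ k → ℝ) (h : ℝ) : Matrix (m ⊕ k) (m ⊕ k) ℝ :=
  Matrix.fromBlocks
    (Matrix.diagonal fun i => (h ^ 2)⁻¹ * v (Sum.inl i)) 0
    0 (Matrix.diagonal fun j => -(h⁻¹ * d (Sum.inr j)))

/-- `B̃`, with diagonal blocks `2h⁻²V₁ + h⁻¹D₁`, `h⁻¹D₂`, `-h⁻¹D₃ - Q₃₃`, upper right blocks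
`-Q₁₃`, `-Q₂₃`, and zero elsewhere. -/
def tildeB (v d : m ⊕ k → ℝ) (Q : Matrix (m ⊕ k) (m ⊕ k) ℝ) (h : ℝ) :
    Matrix (m ⊕ k) (m ⊕ k) ℝ :=
  Matrix.fromBlocks
    (Matrix.diagonal fun i => 2 * (h ^ 2)⁻¹ * v (Sum.inl i) + h⁻¹ * d (Sum.inl i)) (-Q.toBlocks₁₂)
    0 (Matrix.diagonal (fun j => -(h⁻¹ * d (Sum.inr j))) - Q.toBlocks₂₂)

/-- `C̃`, with zero last block column; on `E₁ ∪ E₂` it is `h⁻²V + h⁻¹D + Q`. -/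
def tildeC (v d : m ⊕ k → ℝ) (Q : Matrix (m ⊕ k) (m ⊕ k) ℝ) (h : ℝ) :
    Matrix (m ⊕ k) (m ⊕ k) ℝ :=
  Matrix.fromBlocks
    (Matrix.diagonal (fun i => (h ^ 2)⁻¹ * v (Sum.inl i) + h⁻¹ * d (Sum.inl i)) + Q.toBlocks₁₁) 0
    Q.toBlocks₂₁ 0

/-- `Ψ = -B₁₂ B₂₂⁻¹`. -/
def psi (B : Matrix (m ⊕ k) (m ⊕ k) ℝ) : Matrix m k ℝ := -B.toBlocks₁₂ * B.toBlocks₂₂⁻¹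

/-- `S = B₁₁ + Ψ B₂₁`. -/
def schur (B : Matrix (m ⊕ k) (m ⊕ k) ℝ) : Matrix m m ℝ := B.toBlocks₁₁ + psi B * B.toBlocks₂₁

/-- `Y = (C₁₁ + Ψ C₂₁) S⁻¹`. -/
def pairY (C B : Matrix (m ⊕ k) (m ⊕ k) ℝ) : Matrix m m ℝ :=
  (C.toBlocks₁₁ + psi B * C.toBlocks₂₁) * (schur B)⁻¹

/-- `X = h⁻¹ (Y - I)`. -/
def pairX (C B : Matrix (m ⊕ k) (m ⊕ k) ℝ) (h : ℝ) : Matrix m m ℝ := h⁻¹ • (pairY C B - 1)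

/-- `U = [I  Ψ]`. -/
def pairU (B : Matrix (m ⊕ k) (m ⊕ k) ℝ) : Matrix m (m ⊕ k) ℝ := Matrix.fromCols 1 (psi B)

end Model

/-! ## Subtraction-free expressions -/

/-- Arithmetic expressions in the variables `σ`; the only constants are `0` and `1`, and a
difference `a - b` is written `a + (-b)`. -/
inductive Expr (σ : Type*) where
  | zero : Expr σ
  | one : Expr σ
  | var (s : σ) : Expr σ
  | neg (a : Expr σ) : Expr σ
  | add (a b : Expr σ) : Expr σ
  | mul (a b : Expr σ) : Expr σ
  | div (a b : Expr σ) : Expr σ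

namespace Expr

variable {σ : Type*}

/-- The value of an expression. -/
def eval (x : σ → ℝ) : Expr σ → ℝ
  | zero => 0
  | one => 1
  | var s => x s
  | neg a => -(a.eval x)
  | add a b => a.eval x + b.eval x
  | mul a b => a.eval x * b.eval x
  | div a b => a.eval x / b.eval x

/-- During the evaluation at `x` no two numbers of strictly opposite sign are ever added
(equivalently, no two numbers of the same sign are subtracted), and no divisor is zero. -/
def SubtractionFreeAt (x : σ → ℝ) : Expr σ → Prop
  | zero => True
  | one => True
  | var _ => True
  | neg a => a.SubtractionFreeAt x
  | add a b => a.SubtractionFreeAt x ∧ b.SubtractionFreeAt x ∧ 0 ≤ a.eval x * b.eval x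
  | mul a b => a.SubtractionFreeAt x ∧ b.SubtractionFreeAt x
  | div a b => a.SubtractionFreeAt x ∧ b.SubtractionFreeAt x ∧ b.eval x ≠ 0

/-- Each entry of the matrix of expressions `E` is subtraction-free at `x`, and the values are
the entries of `M`. -/
def Computes {p q : Type*} (E : Matrix p q (Expr σ)) (x : σ → ℝ) (M : Matrix p q ℝ) : Prop :=
  ∀ i j, (E i j).SubtractionFreeAt x ∧ (E i j).eval x = M i j

end Expr

/-- The data from which the pairs are computed: the off-diagonal entries of `B̂_∞` (its diagonal
entries are not available), the entries of `C₀`, the vectors `u` and `v̂`, and `h`. Since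
`u B̂_∞ = u C₀ + v̂`, they contain the triplet representation
`(offdiag(B̂_∞ᵀ), uᵀ, (u C₀ + v̂)ᵀ)` of `B̂_∞ᵀ`. -/
inductive Datum (ι : Type*) where
  | offdiagB (i j : ι) (hij : i ≠ j) : Datum ι
  | entryC (i j : ι) : Datum ι
  | perron (i : ι) : Datum ι
  | limit (i : ι) : Datum ι
  | step : Datum ι

/-- The values of the data. -/
def Datum.value {ι : Type*} (B C : Matrix ι ι ℝ) (u vhat : ι → ℝ) (h : ℝ) : Datum ι → ℝ
  | offdiagB i j _ => B i j
  | entryC i j => C i j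
  | perron i => u i
  | limit i => vhat i
  | step => h

end MMBM

end

/-! Everything rests on the functional iteration `X ↦ B - C X⁻¹ A` started at `B`, where `A, B, C`
denote the coefficients of the shifted polynomial. On the set `X ≤ B`, `u X ≥ u C`, `X 1 ≥ A 1`,
irreducibility makes every `X` a nonsingular M-matrix (`QBDDomain.isMMatrix`). The iteration
preserves this set and decreases entrywise, so it converges to a fixed point `H`. One step of Cyclic
Reduction composes a fractional linear map with itself by the Woodbury identity. Hence `B̂ₙ` is the
iterate of index `2 ^ n - 1`, so `B̂ₙ → H`, and `u Aₙ = u B̂ₙ - u C` converges as well.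

With `R = C H⁻¹` the fixed point equation reads `A y² - B y + C = (y I - R)(y A - H)`. The two
vector inequalities put the eigenvalues of `R` in the closed unit disc and those of `y A - H`
outside the open one. On the unit circle only `1` can occur. It is an eigenvalue of `R` exactly when
`v̂ = 0`, that is, when the drift is not negative, and it is then simple
(`QBDFixed.matEigs_solvent`). The last block column of `C` is zero, so `R` is similar to a block
triangular matrix with diagonal blocks `Y` and `0`, which accounts for the `n₃` deflated zeros.

For `P`, the substitution `y = 1 + h z` and a column scaling by `y` on `E₃` relate the determinants.
The disc `|1 + h z| < 1` is smaller than the left half-plane, but the number of eigenvalues in it is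
determined by the size of `Y` and the drift, so it is the same for all admissible steps. Small steps
capture every eigenvalue with negative real part, hence every admissible step does
(`IsData.filter_eq`).

The expressions come from Gaussian elimination for an M-matrix known through its off-diagonal
entries, a positive `u` and `u X ≥ 0`: pivots are recovered from `u X` as sums of nonnegative terms.
The vector `u C + v̂` supplies these data for `H`, hence for `B₂₂` and `S`. The diagonal of `Y - I`
is treated in the same way through `u₁ (I - Y)`. -/

noncomputable section

namespace MMBM

/-! ## Entrywise nonnegative matrices -/

section Nonneg

variable {l m n : Type*}

theorem one_vec_nonneg : (0 : m → ℝ) ≤ 1 := fun _ => zero_le_one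

variable [Fintype m]

theorem mul_entry_nonneg {M : Matrix l m ℝ} {N : Matrix m n ℝ} (hM : ∀ i j, 0 ≤ M i j)
    (hN : ∀ i j, 0 ≤ N i j) (i : l) (j : n) : 0 ≤ (M * N) i j :=
  Finset.sum_nonneg fun _ _ => mul_nonneg (hM _ _) (hN _ _)

theorem mulVec_nonneg {M : Matrix l m ℝ} {x : m → ℝ} (hM : ∀ i j, 0 ≤ M i j) (hx : 0 ≤ x) :
    0 ≤ M *ᵥ x :=
  fun _ => Finset.sum_nonneg fun _ _ => mul_nonneg (hM _ _) (hx _)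

theorem vecMul_nonneg {M : Matrix m n ℝ} {x : m → ℝ} (hM : ∀ i j, 0 ≤ M i j) (hx : 0 ≤ x) :
    0 ≤ x ᵥ* M :=
  fun _ => Finset.sum_nonneg fun _ _ => mul_nonneg (hx _) (hM _ _)

theorem mulVec_mono {M : Matrix l m ℝ} {x y : m → ℝ} (hM : ∀ i j, 0 ≤ M i j) (h : x ≤ y) :
    M *ᵥ x ≤ M *ᵥ y :=
  fun _ => Finset.sum_le_sum fun _ _ => mul_le_mul_of_nonneg_left (h _) (hM _ _)

theorem vecMul_mono {M : Matrix m n ℝ} {x y : m → ℝ} (hM : ∀ i j, 0 ≤ M i j) (h : x ≤ y) :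
    x ᵥ* M ≤ y ᵥ* M :=
  fun _ => Finset.sum_le_sum fun _ _ => mul_le_mul_of_nonneg_right (h _) (hM _ _)

theorem dotProduct_nonneg_of {x y : m → ℝ} (hx : 0 ≤ x) (hy : 0 ≤ y) : 0 ≤ x ⬝ᵥ y :=
  Finset.sum_nonneg fun _ _ => mul_nonneg (hx _) (hy _)

/-- Turns one scalar inequality into a vector equation: a sum of nonpositive terms that is
nonnegative has only zero terms. -/
theorem eq_zero_of_dotProduct_nonneg {u x : m → ℝ} (hu : ∀ i, 0 < u i) (hx : x ≤ 0)
    (h : 0 ≤ u ⬝ᵥ x) : x = 0 := by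
  have h1 : ∀ i ∈ Finset.univ, u i * x i ≤ 0 := fun i _ =>
    mul_nonpos_of_nonneg_of_nonpos (hu i).le (hx i)
  have h2 : ∑ i, u i * x i = 0 := le_antisymm (Finset.sum_nonpos h1) h
  funext i
  have := (Finset.sum_eq_zero_iff_of_nonpos h1).1 h2 i (Finset.mem_univ i)
  exact (mul_eq_zero.1 this).resolve_left (hu i).ne'

end Nonneg

/-! ## Nonsingular M-matrices -/

section MMatrix

variable {n : Type*} [Fintype n]

/-- A nonsingular M-matrix: a matrix with nonpositive off-diagonal entries such that `X y ≤ 0`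
is impossible for `y ≥ 0`, `y ≠ 0`. -/
structure IsMMatrix (X : Matrix n n ℝ) : Prop where
  offdiag : ∀ i j, i ≠ j → X i j ≤ 0
  eq_zero : ∀ y : n → ℝ, 0 ≤ y → X *ᵥ y ≤ 0 → y = 0

theorem mulVec_nonpos_of_offdiag {X : Matrix n n ℝ} (hX : ∀ i j, i ≠ j → X i j ≤ 0)
    {y : n → ℝ} (hy : 0 ≤ y) {i : n} (hi : y i = 0) : (X *ᵥ y) i ≤ 0 := by
  refine Finset.sum_nonpos fun j _ => ?_
  by_cases h : i = j
  · rw [← h, hi, mul_zero]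
  · exact mul_nonpos_of_nonpos_of_nonneg (hX i j h) (hy j)

/-- The negative part satisfies `X x⁻ ≤ 0`, hence vanishes. In a row with `x i ≥ 0` this follows
from the off-diagonal signs; in a row with `x i ≤ 0` it follows from `X x⁻ = X x⁺ - X x`. -/
theorem IsMMatrix.nonneg_of_mulVec {X : Matrix n n ℝ} (hX : IsMMatrix X) {x : n → ℝ}
    (hx : 0 ≤ X *ᵥ x) : 0 ≤ x := by
  have key : x⁻ = 0 := by
    refine hX.eq_zero _ (negPart_nonneg x) fun i => ?_
    rcases le_total 0 (x i) with h | h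
    · exact mulVec_nonpos_of_offdiag hX.offdiag (negPart_nonneg x) (by simpa using h)
    · have h1 : (X *ᵥ x⁺) i ≤ 0 :=
        mulVec_nonpos_of_offdiag hX.offdiag (posPart_nonneg x) (by simpa using h)
      have h2 : X *ᵥ x⁻ = X *ᵥ x⁺ - X *ᵥ x := by
        rw [← mulVec_sub]; congr 1
        exact (sub_eq_of_eq_add (sub_eq_iff_eq_add'.1 (posPart_sub_negPart x))).symm
      rw [h2]
      have := hx i
      simp only [Pi.sub_apply, Pi.zero_apply] at *
      linarith
  exact negPart_eq_zero.1 key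

theorem IsMMatrix.mulVec_eq_zero {X : Matrix n n ℝ} (hX : IsMMatrix X) {x : n → ℝ}
    (hx : X *ᵥ x = 0) : x = 0 := by
  refine le_antisymm ?_ (hX.nonneg_of_mulVec hx.ge)
  have : 0 ≤ X *ᵥ (-x) := by rw [mulVec_neg, hx, neg_zero]
  exact neg_nonneg.1 (hX.nonneg_of_mulVec this)

variable [DecidableEq n]

theorem IsMMatrix.isUnit_det {X : Matrix n n ℝ} (hX : IsMMatrix X) : IsUnit X.det := by
  rw [isUnit_iff_ne_zero]
  intro h
  obtain ⟨v, hv, hv0⟩ := exists_mulVec_eq_zero_iff.2 h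
  exact hv (hX.mulVec_eq_zero hv0)

theorem IsMMatrix.inv_nonneg {X : Matrix n n ℝ} (hX : IsMMatrix X) (i j : n) :
    0 ≤ X⁻¹ i j := by
  have h : 0 ≤ X⁻¹ *ᵥ Pi.single j 1 := by
    refine hX.nonneg_of_mulVec ?_
    rw [mulVec_mulVec, mul_nonsing_inv _ hX.isUnit_det, one_mulVec]
    exact Pi.single_nonneg.2 zero_le_one
  simpa using h i

theorem IsMMatrix.of_isUnit {X : Matrix n n ℝ} (hX : ∀ i j, i ≠ j → X i j ≤ 0)
    {u : n → ℝ} (hu : ∀ i, 0 < u i) (huX : 0 ≤ u ᵥ* X) (hdet : IsUnit X.det) : IsMMatrix X := by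
  refine ⟨hX, fun y hy hXy => ?_⟩
  have h0 : X *ᵥ y = 0 := by
    refine eq_zero_of_dotProduct_nonneg hu hXy ?_
    rw [dotProduct_mulVec]
    exact dotProduct_nonneg_of huX hy
  by_contra hne
  exact hdet.ne_zero (exists_mulVec_eq_zero_iff.1 ⟨y, hne, h0⟩)

/-- The inverse is antitone on nonsingular M-matrices. -/
theorem IsMMatrix.inv_antitone {X Z : Matrix n n ℝ} (hX : IsMMatrix X) (hZ : IsMMatrix Z)
    (h : ∀ i j, X i j ≤ Z i j) (i j : n) : Z⁻¹ i j ≤ X⁻¹ i j := by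
  have e : X⁻¹ - Z⁻¹ = X⁻¹ * (Z - X) * Z⁻¹ := by
    rw [mul_sub, sub_mul, mul_assoc, mul_nonsing_inv _ hZ.isUnit_det,
      nonsing_inv_mul _ hX.isUnit_det, mul_one, one_mul]
  have : 0 ≤ (X⁻¹ - Z⁻¹) i j := by
    rw [e]
    exact mul_entry_nonneg (mul_entry_nonneg hX.inv_nonneg
      fun i j => sub_nonneg.2 (h i j)) hZ.inv_nonneg i j
  simpa using this

end MMatrix

/-! ## Quasi-birth-death polynomials -/

section QBD

variable {ι : Type*} [Fintype ι]

/-- The sign, irreducibility and null vector properties of `A y² - B y + C` that are used: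
`A - B + C` is an irreducible rate matrix with left Perron vector `u`, and `A` is diagonal. -/
structure QBD (A B C : Matrix ι ι ℝ) (u : ι → ℝ) : Prop where
  A_nonneg : ∀ i j, 0 ≤ A i j
  A_diag : ∀ i j, i ≠ j → A i j = 0
  A_ne_zero : ∃ i, 0 < A i i
  C_nonneg : ∀ i j, 0 ≤ C i j
  B_offdiag : ∀ i j, i ≠ j → B i j ≤ 0
  u_pos : ∀ i, 0 < u i
  left : u ᵥ* (A - B + C) = 0
  right : (A - B + C) *ᵥ 1 = 0
  irred : ∀ S : Set ι, (∀ i, i ∉ S → ∀ j ∈ S, (A - B + C) i j = 0) → S = ∅ ∨ S = Set.univ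

variable {A B C : Matrix ι ι ℝ} {u : ι → ℝ}

theorem QBD.u_nonneg (q : QBD A B C u) : 0 ≤ u := fun i => (q.u_pos i).le

theorem QBD.vecMul_B (q : QBD A B C u) : u ᵥ* B = u ᵥ* C + u ᵥ* A := by
  have := q.left
  rw [vecMul_add, vecMul_sub] at this
  linear_combination (exp := 1) -this

theorem QBD.B_mulVec_one (q : QBD A B C u) : B *ᵥ 1 = A *ᵥ 1 + C *ᵥ 1 := by
  have := q.right
  rw [add_mulVec, sub_mulVec] at this
  linear_combination (exp := 1) -this

theorem QBD.dotProduct_A_pos (q : QBD A B C u) : 0 < u ⬝ᵥ (A *ᵥ 1) := by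
  obtain ⟨i, hi⟩ := q.A_ne_zero
  refine Finset.sum_pos' (fun j _ => mul_nonneg (q.u_nonneg j)
    (mulVec_nonneg q.A_nonneg one_vec_nonneg j)) ⟨i, Finset.mem_univ i, mul_pos (q.u_pos i) ?_⟩
  refine Finset.sum_pos' (fun j _ => mul_nonneg (q.A_nonneg i j) zero_le_one)
    ⟨i, Finset.mem_univ i, by simpa using hi⟩

/-- The matrices between which the functional iteration `X ↦ B - C X⁻¹ A` takes place. -/
structure QBDDomain (A B C : Matrix ι ι ℝ) (u : ι → ℝ) (X : Matrix ι ι ℝ) : Prop where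
  le : ∀ i j, X i j ≤ B i j
  left : u ᵥ* C ≤ u ᵥ* X
  right : A *ᵥ 1 ≤ X *ᵥ 1

/-- If `y ≥ 0` and `X y ≤ 0`, then `0 ≤ u C y ≤ u X y ≤ 0`, so `X y = 0` and `C y = 0`. Entries of
`X`, and hence of `B` and `C`, leading from outside the support of `y` into it are therefore zero.
By irreducibility `y` is zero or strictly positive. In the latter case `u X = 0`, contradicting `u X
1 ≥ u A 1 > 0`. -/
theorem QBDDomain.isMMatrix {X : Matrix ι ι ℝ} (hX : QBDDomain A B C u X) (q : QBD A B C u) :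
    IsMMatrix X := by
  have hoff : ∀ i j, i ≠ j → X i j ≤ 0 := fun i j hij => (hX.le i j).trans (q.B_offdiag i j hij)
  refine ⟨hoff, fun y hy hXy => ?_⟩
  have huC : 0 ≤ u ᵥ* C := vecMul_nonneg q.C_nonneg q.u_nonneg
  have hCy : 0 ≤ C *ᵥ y := mulVec_nonneg q.C_nonneg hy
  have h1 : 0 ≤ (u ᵥ* X - u ᵥ* C) ⬝ᵥ y := dotProduct_nonneg_of (sub_nonneg.2 hX.left) hy
  have h2 : 0 ≤ (u ᵥ* C) ⬝ᵥ y := dotProduct_nonneg_of huC hy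
  rw [sub_dotProduct] at h1
  have h3 : X *ᵥ y = 0 := by
    refine eq_zero_of_dotProduct_nonneg q.u_pos hXy ?_
    rw [dotProduct_mulVec]; linarith
  have h4 : (u ᵥ* X) ⬝ᵥ y = 0 := by rw [← dotProduct_mulVec, h3, dotProduct_zero]
  have h5 : C *ᵥ y = 0 := by
    have := eq_zero_of_dotProduct_nonneg q.u_pos (x := -(C *ᵥ y)) (neg_nonpos.2 hCy)
      (by rw [dotProduct_neg, dotProduct_mulVec]; linarith)
    simpa using this
  have hS : ∀ i, i ∉ {i | 0 < y i} → ∀ j ∈ {i | 0 < y i}, (A - B + C) i j = 0 := by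
    intro i hi j hj
    have hi0 : y i = 0 := le_antisymm (not_lt.1 hi) (hy i)
    have hj' : 0 < y j := hj
    have hij : i ≠ j := by rintro rfl; exact hj'.ne' hi0
    have hXij : X i j = 0 := by
      have hs : ∀ k ∈ Finset.univ, X i k * y k ≤ 0 := fun k _ => by
        by_cases h : i = k
        · rw [← h, hi0, mul_zero]
        · exact mul_nonpos_of_nonpos_of_nonneg (hoff i k h) (hy k)
      have := (Finset.sum_eq_zero_iff_of_nonpos hs).1 (congrFun h3 i) j (Finset.mem_univ j)
      exact (mul_eq_zero.1 this).resolve_right hj'.ne'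
    have hCij : C i j = 0 := by
      have hs : ∀ k ∈ Finset.univ, 0 ≤ C i k * y k := fun k _ =>
        mul_nonneg (q.C_nonneg i k) (hy k)
      have := (Finset.sum_eq_zero_iff_of_nonneg hs).1 (congrFun h5 i) j (Finset.mem_univ j)
      exact (mul_eq_zero.1 this).resolve_right hj'.ne'
    have hBij : B i j = 0 := le_antisymm (q.B_offdiag i j hij) (hXij ▸ hX.le i j)
    simp [q.A_diag i j hij, hBij, hCij]
  rcases q.irred _ hS with h | h
  · funext i
    have : i ∉ {i | 0 < y i} := by rw [h]; simp
    exact le_antisymm (not_lt.1 this) (hy i)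
  · exfalso
    have hpos : ∀ i, 0 < y i := fun i => by
      have : i ∈ {i | 0 < y i} := by rw [h]; trivial
      exact this
    have huX : u ᵥ* X = 0 := by
      have := eq_zero_of_dotProduct_nonneg hpos (x := -(u ᵥ* X))
        (neg_nonpos.2 (huC.trans hX.left))
        (by rw [dotProduct_neg, dotProduct_comm, h4, neg_zero])
      simpa using this
    have h6 : u ⬝ᵥ (X *ᵥ 1) = 0 := by rw [dotProduct_mulVec, huX, zero_dotProduct]
    have h7 : 0 ≤ u ⬝ᵥ (X *ᵥ 1 - A *ᵥ 1) :=
      dotProduct_nonneg_of q.u_nonneg (sub_nonneg.2 hX.right)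
    rw [dotProduct_sub, h6] at h7
    linarith [q.dotProduct_A_pos]

theorem QBD.domain_B (q : QBD A B C u) : QBDDomain A B C u B where
  le _ _ := le_rfl
  left := by
    rw [q.vecMul_B]
    exact le_add_of_nonneg_right (vecMul_nonneg q.A_nonneg q.u_nonneg)
  right := by
    rw [q.B_mulVec_one]
    exact le_add_of_nonneg_right (mulVec_nonneg q.C_nonneg one_vec_nonneg)

variable [DecidableEq ι]

/-- The functional iteration `X ↦ B - C X⁻¹ A`. -/
def qbdStep (A B C X : Matrix ι ι ℝ) : Matrix ι ι ℝ := B - C * X⁻¹ * A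

/-- This bound and the next keep the iteration in its domain; at the fixed point they bound the
spectra of the two factors. -/
theorem QBDDomain.vecMul_inv_le {X : Matrix ι ι ℝ} (hX : QBDDomain A B C u X)
    (q : QBD A B C u) : u ᵥ* (C * X⁻¹) ≤ u := by
  have h := vecMul_mono (hX.isMMatrix q).inv_nonneg hX.left
  rwa [vecMul_vecMul, vecMul_vecMul, mul_nonsing_inv _ (hX.isMMatrix q).isUnit_det,
    vecMul_one] at h

theorem QBDDomain.inv_mulVec_le {X : Matrix ι ι ℝ} (hX : QBDDomain A B C u X)
    (q : QBD A B C u) : (X⁻¹ * A) *ᵥ 1 ≤ 1 := by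
  have h := mulVec_mono (hX.isMMatrix q).inv_nonneg hX.right
  rwa [mulVec_mulVec, mulVec_mulVec, nonsing_inv_mul _ (hX.isMMatrix q).isUnit_det,
    one_mulVec] at h

theorem QBDDomain.step {X : Matrix ι ι ℝ} (hX : QBDDomain A B C u X) (q : QBD A B C u) :
    QBDDomain A B C u (qbdStep A B C X) where
  le i j := by
    have := mul_entry_nonneg (mul_entry_nonneg q.C_nonneg (hX.isMMatrix q).inv_nonneg)
      q.A_nonneg i j
    simpa [qbdStep] using this
  left := by
    have h := vecMul_mono q.A_nonneg (hX.vecMul_inv_le q)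
    rw [vecMul_vecMul] at h
    rw [qbdStep, vecMul_sub, q.vecMul_B]
    intro i
    have := h i
    simp only [Pi.sub_apply, Pi.add_apply]
    linarith
  right := by
    have h := mulVec_mono q.C_nonneg (hX.inv_mulVec_le q)
    rw [mulVec_mulVec, ← mul_assoc] at h
    rw [qbdStep, sub_mulVec, q.B_mulVec_one]
    intro i
    have := h i
    simp only [Pi.sub_apply, Pi.add_apply]
    linarith

/-- Inversion reverses the order of M-matrices and the minus sign reverses it back. -/
theorem QBDDomain.step_mono {X Z : Matrix ι ι ℝ} (hX : QBDDomain A B C u X)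
    (hZ : QBDDomain A B C u Z) (q : QBD A B C u) (h : ∀ i j, X i j ≤ Z i j) (i j : ι) :
    qbdStep A B C X i j ≤ qbdStep A B C Z i j := by
  have h1 : qbdStep A B C Z - qbdStep A B C X = C * (X⁻¹ - Z⁻¹) * A := by
    simp only [qbdStep, mul_sub, sub_mul]; abel
  have h2 : 0 ≤ (qbdStep A B C Z - qbdStep A B C X) i j := by
    rw [h1]
    exact mul_entry_nonneg (mul_entry_nonneg q.C_nonneg fun i j => sub_nonneg.2
      ((hX.isMMatrix q).inv_antitone (hZ.isMMatrix q) h i j)) q.A_nonneg i j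
  simpa using h2

theorem QBDDomain.iterate {X : Matrix ι ι ℝ} (hX : QBDDomain A B C u X) (q : QBD A B C u)
    (n : ℕ) : QBDDomain A B C u ((qbdStep A B C)^[n] X) := by
  induction n with
  | zero => exact hX
  | succ n ih => rw [Function.iterate_succ_apply']; exact ih.step q

theorem QBD.iterate_antitone (q : QBD A B C u) (n : ℕ) (i j : ι) :
    (qbdStep A B C)^[n + 1] B i j ≤ (qbdStep A B C)^[n] B i j := by
  induction n generalizing i j with
  | zero => exact (q.domain_B.step q).le i j
  | succ n ih =>
    rw [Function.iterate_succ_apply' _ (n + 1), Function.iterate_succ_apply' _ n]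
    rw [Function.iterate_succ_apply'] at ih
    exact ((q.domain_B.iterate q n).step q).step_mono (q.domain_B.iterate q n) q ih i j

/-- The entries of the matrices in the domain are bounded below. -/
theorem QBDDomain.lower_bound {X : Matrix ι ι ℝ} (hX : QBDDomain A B C u X) (q : QBD A B C u)
    (i j : ι) : (u i)⁻¹ * -(∑ k, u k * |B k j|) ≤ X i j := by
  have h0 : 0 ≤ (u ᵥ* X) j := (vecMul_nonneg q.C_nonneg q.u_nonneg).trans hX.left j
  have h1 : (u ᵥ* X) j = ∑ k, u k * X k j := rfl
  have h2 : ∑ k ∈ Finset.univ.erase i, u k * X k j ≤ ∑ k, u k * |B k j| := by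
    refine (Finset.sum_le_sum fun k _ => mul_le_mul_of_nonneg_left
      ((hX.le k j).trans (le_abs_self _)) (q.u_nonneg k)).trans
      (Finset.sum_le_sum_of_subset_of_nonneg (Finset.erase_subset _ _) fun k _ _ =>
        mul_nonneg (q.u_nonneg k) (abs_nonneg _))
  rw [h1, ← Finset.add_sum_erase _ _ (Finset.mem_univ i)] at h0
  rw [inv_mul_le_iff₀ (q.u_pos i)]
  linarith

/-- The functional iteration converges to a fixed point in the domain. -/
theorem QBD.exists_limit (q : QBD A B C u) :
    ∃ H, QBDDomain A B C u H ∧ qbdStep A B C H = H ∧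
      Tendsto (fun n => (qbdStep A B C)^[n] B) atTop (𝓝 H) := by
  have hconv : ∀ i j, ∃ x, Tendsto (fun n => (qbdStep A B C)^[n] B i j) atTop (𝓝 x) := by
    intro i j
    refine ⟨_, tendsto_atTop_ciInf (antitone_nat_of_succ_le fun n => q.iterate_antitone n i j) ?_⟩
    refine ⟨(u i)⁻¹ * -(∑ k, u k * |B k j|), ?_⟩
    rintro _ ⟨n, rfl⟩
    exact (q.domain_B.iterate q n).lower_bound q i j
  choose H hH using hconv
  have hlim : Tendsto (fun n => (qbdStep A B C)^[n] B) atTop (𝓝 (Matrix.of H)) :=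
    tendsto_pi_nhds.2 fun i => tendsto_pi_nhds.2 fun j => hH i j
  have hdom : QBDDomain A B C u (Matrix.of H) := by
    refine ⟨fun i j => le_of_tendsto (hH i j) (Eventually.of_forall fun n =>
      (q.domain_B.iterate q n).le i j), ?_, ?_⟩
    · have hc : Continuous fun X : Matrix ι ι ℝ => u ᵥ* X :=
        Continuous.matrix_vecMul continuous_const continuous_id
      exact ge_of_tendsto ((hc.tendsto _).comp hlim)
        (Eventually.of_forall fun n => (q.domain_B.iterate q n).left)
    · have hc : Continuous fun X : Matrix ι ι ℝ => X *ᵥ (1 : ι → ℝ) :=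
        Continuous.matrix_mulVec continuous_id continuous_const
      exact ge_of_tendsto ((hc.tendsto _).comp hlim)
        (Eventually.of_forall fun n => (q.domain_B.iterate q n).right)
  refine ⟨_, hdom, ?_, hlim⟩
  have hinv : ContinuousAt (fun X : Matrix ι ι ℝ => X⁻¹) (Matrix.of H) := by
    have hd := (hdom.isMMatrix q).isUnit_det
    have : (fun X : Matrix ι ι ℝ => X⁻¹) = fun X => (X.det)⁻¹ • X.adjugate := by
      funext X; rw [Matrix.inv_def, Ring.inverse_eq_inv']
    rw [this]
    exact (ContinuousAt.inv₀ (continuous_id.matrix_det.continuousAt) hd.ne_zero).smul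
      continuous_id.matrix_adjugate.continuousAt
  have hcont : ContinuousAt (qbdStep A B C) (Matrix.of H) := by
    have h1 : Continuous fun Z : Matrix ι ι ℝ => B - C * Z * A := by fun_prop
    exact h1.continuousAt.comp hinv
  refine tendsto_nhds_unique (hcont.tendsto.comp hlim) ?_
  have := hlim.comp (tendsto_add_atTop_nat 1)
  refine this.congr fun n => ?_
  simp only [Function.comp, Function.iterate_succ_apply']

end QBD

/-! ## Cyclic Reduction -/

section CRConvergence

variable {ι : Type*} [Fintype ι] [DecidableEq ι]

/-- Both matrices are Schur complements in the block matrix with rows `(b, c)` and `(a, z)`, so one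
is invertible if and only if the other is. The formula is the Woodbury identity. -/
theorem inv_sub_mul_inv_mul {b z a c : Matrix ι ι ℝ} (hb : IsUnit b.det) (hz : IsUnit z.det)
    (hw : IsUnit (b - c * z⁻¹ * a).det) :
    IsUnit (z - a * b⁻¹ * c).det ∧
      (b - c * z⁻¹ * a)⁻¹ = b⁻¹ + b⁻¹ * c * (z - a * b⁻¹ * c)⁻¹ * a * b⁻¹ := by
  have hdet : b.det * (z - a * b⁻¹ * c).det = z.det * (b - c * z⁻¹ * a).det := by
    let _ := invertibleOfIsUnitDet b hb
    let _ := invertibleOfIsUnitDet z hz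
    have h1 := det_fromBlocks₁₁ b c a z
    have h2 := det_fromBlocks₂₂ b c a z
    rw [invOf_eq_nonsing_inv] at h1 h2
    rw [← h1, ← h2]
  have hu : IsUnit (z - a * b⁻¹ * c).det :=
    isUnit_of_mul_isUnit_right (hdet ▸ hz.mul hw)
  refine ⟨hu, ?_⟩
  have hz' : IsUnit z := (isUnit_iff_isUnit_det z).2 hz
  have := add_mul_mul_inv_eq_sub (A := b) (U := -c) (C := z⁻¹) (V := a)
    ((isUnit_iff_isUnit_det b).2 hb) ((isUnit_nonsing_inv_iff).2 hz')
    (by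
      rw [nonsing_inv_nonsing_inv _ hz, isUnit_iff_isUnit_det]
      simpa [sub_eq_add_neg] using hu)
  rw [nonsing_inv_nonsing_inv _ hz] at this
  simpa [sub_eq_add_neg] using this

variable {A B C : Matrix ι ι ℝ} {u : ι → ℝ}

/-- The properties of the iterates of Cyclic Reduction that propagate from step to step; the
last two fields identify step `n` with `2 ^ n` steps of the functional iteration. -/
structure CRInvariant (A B C : Matrix ι ι ℝ) (u : ι → ℝ) (n : ℕ) (s : CRState ι) : Prop where
  A_nonneg : ∀ i j, 0 ≤ s.A i j
  C_nonneg : ∀ i j, 0 ≤ s.C i j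
  B_offdiag : ∀ i j, i ≠ j → s.B i j ≤ 0
  vecMul_B : u ᵥ* s.B = u ᵥ* s.C + u ᵥ* s.A
  vecMul_Bhat : u ᵥ* s.Bhat = u ᵥ* C + u ᵥ* s.A
  domain : QBDDomain A B C u s.Bhat
  isUnit : ∀ X, QBDDomain A B C u X → IsUnit (X + (s.B - s.Bhat)).det
  iterate : ∀ X, QBDDomain A B C u X →
    (qbdStep A B C)^[2 ^ n] X = s.Bhat - s.C * (X + (s.B - s.Bhat))⁻¹ * s.A
  Bhat_eq : s.Bhat = (qbdStep A B C)^[2 ^ n - 1] B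

theorem CRInvariant.isUnit_B {n : ℕ} {s : CRState ι} (h : CRInvariant A B C u n s) :
    IsUnit s.B.det := by
  -- At `X = B̂` the shifted matrix `X + (B - B̂)` is `B` itself.
  simpa using h.isUnit _ h.domain

theorem CRInvariant.isMMatrix_B {n : ℕ} {s : CRState ι} (h : CRInvariant A B C u n s)
    (q : QBD A B C u) : IsMMatrix s.B := by
  refine IsMMatrix.of_isUnit h.B_offdiag q.u_pos ?_ h.isUnit_B
  rw [h.vecMul_B]
  exact add_nonneg (vecMul_nonneg h.C_nonneg q.u_nonneg) (vecMul_nonneg h.A_nonneg q.u_nonneg)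

theorem CRInvariant.zero (q : QBD A B C u) : CRInvariant A B C u 0 ⟨A, B, C, B⟩ where
  A_nonneg := q.A_nonneg
  C_nonneg := q.C_nonneg
  B_offdiag := q.B_offdiag
  vecMul_B := q.vecMul_B
  vecMul_Bhat := q.vecMul_B
  domain := q.domain_B
  isUnit X hX := by simpa using (hX.isMMatrix q).isUnit_det
  iterate X _ := by simp [qbdStep]
  Bhat_eq := rfl

/-- Applying the map of step `n` twice puts `B - C (X + B - B̂)⁻¹ A` in the place of the inverted
matrix. Expanding its inverse by Woodbury gives a map of the same form, whose coefficients are those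
of the next step. -/
theorem CRInvariant.succ {n : ℕ} {s : CRState ι} (h : CRInvariant A B C u n s)
    (q : QBD A B C u) : CRInvariant A B C u (n + 1) (crStep s) := by
  have hB := h.isMMatrix_B q
  have hBu := hB.isUnit_det
  have hsum : u ᵥ* (s.C * s.B⁻¹) + u ᵥ* (s.A * s.B⁻¹) = u := by
    have := congrArg (· ᵥ* s.B⁻¹) h.vecMul_B
    simp only [add_vecMul, vecMul_vecMul, mul_nonsing_inv _ hBu, vecMul_one] at this
    exact this.symm
  have hAA := mul_entry_nonneg (mul_entry_nonneg h.A_nonneg hB.inv_nonneg) h.A_nonneg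
  have hAC := mul_entry_nonneg (mul_entry_nonneg h.A_nonneg hB.inv_nonneg) h.C_nonneg
  have hCA := mul_entry_nonneg (mul_entry_nonneg h.C_nonneg hB.inv_nonneg) h.A_nonneg
  have hCC := mul_entry_nonneg (mul_entry_nonneg h.C_nonneg hB.inv_nonneg) h.C_nonneg
  have lA : u ᵥ* (s.C * s.B⁻¹ * s.A) + u ᵥ* (s.A * s.B⁻¹ * s.A) = u ᵥ* s.A := by
    rw [← vecMul_vecMul _ _ s.A, ← vecMul_vecMul _ _ s.A, ← add_vecMul, hsum]
  have lC : u ᵥ* (s.C * s.B⁻¹ * s.C) + u ᵥ* (s.A * s.B⁻¹ * s.C) = u ᵥ* s.C := by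
    rw [← vecMul_vecMul _ _ s.C, ← vecMul_vecMul _ _ s.C, ← add_vecMul, hsum]
  have hBhat : (crStep s).Bhat = (qbdStep A B C)^[2 ^ n] s.Bhat := by
    rw [h.iterate _ h.domain]; simp [crStep]
  have hZ : ∀ X, X + ((crStep s).B - (crStep s).Bhat) =
      X + (s.B - s.Bhat) - s.A * s.B⁻¹ * s.C := by
    intro X; simp only [crStep]; abel
  -- This Schur complement is the shifted matrix at the iterate of `X`, which stays in the domain;
  -- the induction hypothesis makes it invertible.
  have hW : ∀ X, QBDDomain A B C u X →
      s.B - s.C * (X + (s.B - s.Bhat))⁻¹ * s.A =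
        (qbdStep A B C)^[2 ^ n] X + (s.B - s.Bhat) := by
    intro X hX; rw [h.iterate X hX]; abel
  have hwood := fun X (hX : QBDDomain A B C u X) =>
    inv_sub_mul_inv_mul hBu (h.isUnit X hX)
      (hW X hX ▸ h.isUnit _ (hX.iterate q (2 ^ n)))
  refine ⟨hAA, hCC, fun i j hij => ?_, ?_, ?_, ?_, fun X hX => ?_, fun X hX => ?_, ?_⟩
  · have h1 := h.B_offdiag i j hij
    have h2 := hAC i j
    have h3 := hCA i j
    simp only [crStep, Matrix.sub_apply]
    linarith
  · simp only [crStep, vecMul_sub, h.vecMul_B]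
    linear_combination (exp := 1) -lA - lC
  · simp only [crStep, vecMul_sub, h.vecMul_Bhat]
    linear_combination (exp := 1) -lA
  · rw [hBhat]; exact h.domain.iterate q _
  · rw [hZ]; exact (hwood X hX).1
  · rw [pow_succ, mul_two, Function.iterate_add_apply, h.iterate _ (hX.iterate q _), ← hW X hX,
      (hwood X hX).2, hZ]
    simp only [crStep, mul_add, add_mul, mul_assoc]
    abel
  · rw [hBhat, h.Bhat_eq, ← Function.iterate_add_apply]
    -- The count is `2 ^ n + (2 ^ n - 1) = 2 ^ (n + 1) - 1`; the truncated subtraction needs `1 ≤ 2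
    -- ^ n`.
    congr 1
    have := Nat.one_le_two_pow (n := n)
    rw [pow_succ]
    omega

theorem QBD.crInvariant (q : QBD A B C u) (n : ℕ) : CRInvariant A B C u n (cr A B C n) := by
  induction n with
  | zero => exact CRInvariant.zero q
  | succ n ih => exact ih.succ q

/-- Cyclic Reduction converges to the limit of the functional iteration. -/
theorem QBD.cr_tendsto (q : QBD A B C u) :
    ∃ H, QBDDomain A B C u H ∧ qbdStep A B C H = H ∧
      Tendsto (fun n => (cr A B C n).Bhat) atTop (𝓝 H) ∧
      Tendsto (fun n => u ᵥ* (cr A B C n).A) atTop (𝓝 (u ᵥ* H - u ᵥ* C)) := by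
  obtain ⟨H, hH, hfix, hlim⟩ := q.exists_limit
  have h1 : Tendsto (fun n => (cr A B C n).Bhat) atTop (𝓝 H) := by
    have ht : Tendsto (fun n : ℕ => 2 ^ n - 1) atTop atTop :=
      (tendsto_sub_atTop_nat 1).comp (tendsto_pow_atTop_atTop_of_one_lt one_lt_two)
    exact (hlim.comp ht).congr fun n => ((q.crInvariant n).Bhat_eq).symm
  refine ⟨H, hH, hfix, h1, ?_⟩
  have hc : Continuous fun X : Matrix ι ι ℝ => u ᵥ* X - u ᵥ* C :=
    (Continuous.matrix_vecMul continuous_const continuous_id).sub continuous_const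
  refine ((hc.tendsto H).comp h1).congr fun n => ?_
  simp only [Function.comp, (q.crInvariant n).vecMul_Bhat, add_sub_cancel_left]

end CRConvergence

/-! ## Spectral properties -/

section Spectrum

open Polynomial

variable {ι : Type*} [Fintype ι]

/-- The moduli of a left eigenvector satisfy `|c| |x| ≤ |x| W`; pairing with `w` gives `|c| (|x| w)
≤ |x| w`, and `|x| w > 0`. -/
theorem norm_le_one_of_isRoot [DecidableEq ι] {W : Matrix ι ι ℝ} {w : ι → ℝ}
    (hW : ∀ i j, 0 ≤ W i j) (hw : ∀ i, 0 < w i) (hWw : W *ᵥ w ≤ w) {c : ℂ}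
    (hc : (W.map (algebraMap ℝ ℂ)).charpoly.IsRoot c) : ‖c‖ ≤ 1 := by
  rw [IsRoot, Matrix.eval_charpoly] at hc
  obtain ⟨x, hx0, hx⟩ := exists_vecMul_eq_zero_iff.2 hc
  have h1 : ∀ j, c * x j = ∑ i, x i * (W i j : ℂ) := by
    intro j
    have := congrFun hx j
    rw [vecMul_sub] at this
    simp only [Pi.sub_apply, Pi.zero_apply, scalar_apply, vecMul_diagonal, sub_eq_zero] at this
    rw [mul_comm, this]
    simp [vecMul, dotProduct]
  have h2 : ∀ j, ‖c‖ * ‖x j‖ ≤ ∑ i, ‖x i‖ * W i j := by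
    intro j
    rw [← norm_mul, h1]
    refine (norm_sum_le _ _).trans (Finset.sum_le_sum fun i _ => ?_)
    rw [norm_mul, Complex.norm_real, Real.norm_of_nonneg (hW i j)]
  have h3 : ‖c‖ * ∑ j, ‖x j‖ * w j ≤ ∑ i, ‖x i‖ * w i := by
    calc ‖c‖ * ∑ j, ‖x j‖ * w j = ∑ j, (‖c‖ * ‖x j‖) * w j := by
          rw [Finset.mul_sum]; exact Finset.sum_congr rfl fun _ _ => by ring
      _ ≤ ∑ j, (∑ i, ‖x i‖ * W i j) * w j :=
          Finset.sum_le_sum fun j _ => mul_le_mul_of_nonneg_right (h2 j) (hw j).le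
      _ = ∑ i, ‖x i‖ * (W *ᵥ w) i := by
          simp only [Finset.sum_mul, mulVec, dotProduct, Finset.mul_sum]
          rw [Finset.sum_comm]
          exact Finset.sum_congr rfl fun _ _ => Finset.sum_congr rfl fun _ _ => by ring
      _ ≤ ∑ i, ‖x i‖ * w i :=
          Finset.sum_le_sum fun i _ => mul_le_mul_of_nonneg_left (hWw i) (norm_nonneg _)
  obtain ⟨i, hi⟩ := Function.ne_iff.1 hx0
  have h4 : 0 < ∑ i, ‖x i‖ * w i := Finset.sum_pos'
    (fun j _ => mul_nonneg (norm_nonneg _) (hw j).le)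
    ⟨i, Finset.mem_univ i, mul_pos (norm_pos_iff.2 hi) (hw i)⟩
  exact le_of_mul_le_mul_right (by simpa using h3) h4

variable {A B C : Matrix ι ι ℝ} {u : ι → ℝ}

theorem QBD.rate_offdiag (q : QBD A B C u) {i j : ι} (hij : i ≠ j) : 0 ≤ (A - B + C) i j := by
  have h1 := q.A_diag i j hij
  have h2 := q.B_offdiag i j hij
  have h3 := q.C_nonneg i j
  simp only [Matrix.add_apply, Matrix.sub_apply]
  linarith

/-- Where `a j = 0`, the `j`-th equation is a vanishing sum of nonnegative terms, so no rate leads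
from the support of `a` to its zero set; irreducibility applies. -/
theorem QBD.pos_of_vecMul_eq_zero (q : QBD A B C u) {a : ι → ℝ} (ha : 0 ≤ a)
    (h : a ᵥ* (A - B + C) = 0) (ha0 : a ≠ 0) (i : ι) : 0 < a i := by
  have hS : ∀ i, i ∉ {i | a i = 0} → ∀ j ∈ {i | a i = 0}, (A - B + C) i j = 0 := by
    intro i hi j hj
    have hj0 : a j = 0 := hj
    have hs : ∀ k ∈ Finset.univ, 0 ≤ a k * (A - B + C) k j := fun k _ => by
      by_cases hk : k = j
      · rw [hk, hj0, zero_mul]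
      · exact mul_nonneg (ha k) (q.rate_offdiag hk)
    have := (Finset.sum_eq_zero_iff_of_nonneg hs).1 (congrFun h j) i (Finset.mem_univ i)
    exact (mul_eq_zero.1 this).resolve_left hi
  rcases q.irred _ hS with h | h
  · refine lt_of_le_of_ne (ha i) fun h0 => ?_
    have : i ∈ {i | a i = 0} := h0.symm
    simp [h] at this
  · refine absurd (funext fun i => ?_) ha0
    have : i ∈ {i | a i = 0} := h ▸ Set.mem_univ i
    exact this

/-- Subtracting from `x` the largest multiple of `u` below it leaves a nonnegative null vector with
a zero entry, which must vanish. -/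
theorem QBD.eq_smul_of_vecMul_eq_zero (q : QBD A B C u) {x : ι → ℝ}
    (h : x ᵥ* (A - B + C) = 0) : ∃ c : ℝ, x = c • u := by
  obtain ⟨i₀, _⟩ := q.A_ne_zero
  obtain ⟨i, _, hi⟩ := Finset.exists_min_image Finset.univ (fun i => x i / u i)
    ⟨i₀, Finset.mem_univ i₀⟩
  refine ⟨x i / u i, ?_⟩
  by_contra hne
  have h1 : 0 ≤ x - (x i / u i) • u := fun j => by
    have := hi j (Finset.mem_univ j)
    rw [le_div_iff₀ (q.u_pos j)] at this
    simpa using this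
  have h2 : (x - (x i / u i) • u) ᵥ* (A - B + C) = 0 := by
    rw [sub_vecMul, smul_vecMul, h, q.left, smul_zero, sub_zero]
  have := q.pos_of_vecMul_eq_zero h1 h2 (sub_ne_zero.2 hne) i
  simp [(q.u_pos i).ne'] at this

theorem QBD.B_pos (q : QBD A B C u) {i : ι} (hi : 0 < A i i) : 0 < B i i := by
  have h1 : u i * A i i ≤ (u ᵥ* A) i :=
    Finset.single_le_sum (f := fun k => u k * A k i)
      (fun k _ => mul_nonneg (q.u_nonneg k) (q.A_nonneg k i)) (Finset.mem_univ i)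
  have h2 : (u ᵥ* A) i ≤ (u ᵥ* B) i := by
    rw [q.vecMul_B]
    exact le_add_of_nonneg_left (vecMul_nonneg q.C_nonneg q.u_nonneg i)
  have h3 : (u ᵥ* B) i ≤ u i * B i i := by
    classical
    have : (u ᵥ* B) i = ∑ k, u k * B k i := rfl
    rw [this, ← Finset.add_sum_erase _ _ (Finset.mem_univ i)]
    have : ∑ k ∈ Finset.univ.erase i, u k * B k i ≤ 0 := Finset.sum_nonpos fun k hk =>
      mul_nonpos_of_nonneg_of_nonpos (q.u_nonneg k) (q.B_offdiag k i (Finset.ne_of_mem_erase hk))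
    linarith
  have h4 := mul_pos (q.u_pos i) hi
  exact pos_of_mul_pos_right (h4.trans_le (h1.trans (h2.trans h3))) (q.u_nonneg i)

/-- Dividing by `|y| = 1` leaves `|b - a y| ≤ b - a`; squaring gives `Re y ≥ 1`. -/
theorem eq_one_of_norm_sub_le {a b : ℝ} (ha : 0 < a) (hb : 0 < b) {y : ℂ} (hy : ‖y‖ = 1)
    (h : ‖(b : ℂ) * y - a * y ^ 2‖ ≤ b - a) : y = 1 := by
  have h1 : ‖(b : ℂ) - a * y‖ ≤ b - a := by
    have : (b : ℂ) * y - a * y ^ 2 = (b - a * y) * y := by ring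
    rwa [this, norm_mul, hy, mul_one] at h
  have h2 : ‖(b : ℂ) - a * y‖ ^ 2 ≤ (b - a) ^ 2 := pow_le_pow_left₀ (norm_nonneg _) h1 2
  have h3 : y.re * y.re + y.im * y.im = 1 := by
    rw [← Complex.normSq_apply, Complex.normSq_eq_norm_sq, hy, one_pow]
  rw [← Complex.normSq_eq_norm_sq, Complex.normSq_apply] at h2
  simp at h2
  have h4 : 1 ≤ y.re := by
    have e : a ^ 2 * (y.re * y.re + y.im * y.im) = a ^ 2 * 1 := by rw [h3]
    have : 0 ≤ (a * b) * (y.re - 1) := by linarith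
    have := nonneg_of_mul_nonneg_right this (mul_pos ha hb)
    linarith
  have h5 : y.im = 0 := by nlinarith
  have h6 : y.re = 1 := by nlinarith
  exact Complex.ext h6 h5

/-- The vector in the definition is a positive multiple of `u`, so the sign of the drift does not
depend on its choice. -/
theorem QBD.dPositiveRecurrent_iff (q : QBD A B C u) :
    DPositiveRecurrent A B C ↔ u ⬝ᵥ ((C - A) *ᵥ 1) < 0 := by
  refine ⟨?_, fun h => ⟨u, q.u_pos, q.left, h⟩⟩
  rintro ⟨w, hw, hw0, h⟩
  obtain ⟨c, rfl⟩ := q.eq_smul_of_vecMul_eq_zero hw0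
  obtain ⟨i, _⟩ := q.A_ne_zero
  have hc : 0 < c := pos_of_mul_pos_left (hw i) (q.u_nonneg i)
  rw [smul_dotProduct, smul_eq_mul] at h
  exact (pos_iff_neg_of_mul_neg h).1 hc

variable [DecidableEq ι]

theorem eval_det_quadPoly (P₂ P₁ P₀ : Matrix ι ι ℝ) (y : ℂ) :
    (quadPoly P₂ P₁ P₀).det.eval y =
      (Matrix.of fun i j => (P₂ i j : ℂ) * y ^ 2 + (P₁ i j : ℂ) * y + (P₀ i j : ℂ)).det := by
  rw [← coe_evalRingHom, RingHom.map_det]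
  congr 1
  ext i j
  simp [quadPoly]

/-- The only eigenvalue on the unit circle is `1`. -/
theorem QBD.eq_one_of_isRoot (q : QBD A B C u) {y : ℂ} (hy : ‖y‖ = 1)
    (h : (quadPoly A (-B) C).det.IsRoot y) : y = 1 := by
  rw [IsRoot, eval_det_quadPoly] at h
  obtain ⟨x, hx0, hx⟩ := exists_vecMul_eq_zero_iff.2 h
  set a : ι → ℝ := fun i => ‖x i‖ with ha
  -- The diagonal terms of `A` and `B` are isolated in column `j` of the null equation; all
  -- remaining coefficients become nonnegative after taking moduli on the unit circle.
  have key : ∀ j, a j * ‖(B j j : ℂ) * y - A j j * y ^ 2‖ ≤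
      (a ᵥ* (A - B + C)) j + a j * (B j j - A j j) := by
    intro j
    have hsum : ∑ i, x i * ((A i j : ℂ) * y ^ 2 + ((-B) i j : ℝ) * y + (C i j : ℂ)) = 0 :=
      congrFun hx j
    rw [← Finset.add_sum_erase _ _ (Finset.mem_univ j)] at hsum
    have h1 : x j * ((B j j : ℂ) * y - A j j * y ^ 2) = x j * C j j +
        ∑ i ∈ Finset.univ.erase j, x i * ((-B i j : ℝ) * y + (C i j : ℂ)) := by
      have : ∑ i ∈ Finset.univ.erase j, x i * ((-B i j : ℝ) * y + (C i j : ℂ)) =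
          ∑ i ∈ Finset.univ.erase j,
            x i * ((A i j : ℂ) * y ^ 2 + ((-B) i j : ℝ) * y + (C i j : ℂ)) :=
        Finset.sum_congr rfl fun i hi => by
          simp [q.A_diag i j (Finset.ne_of_mem_erase hi)]
      rw [this]
      simp only [Matrix.neg_apply, Complex.ofReal_neg] at hsum ⊢
      linear_combination -hsum
    have h2 : (a ᵥ* (A - B + C)) j = a j * (A j j - B j j + C j j) +
        ∑ i ∈ Finset.univ.erase j, a i * (-B i j + C i j) := by
      have : (a ᵥ* (A - B + C)) j = ∑ i, a i * (A i j - B i j + C i j) := rfl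
      rw [this, ← Finset.add_sum_erase _ _ (Finset.mem_univ j)]
      congr 1
      exact Finset.sum_congr rfl fun i hi => by
        rw [q.A_diag i j (Finset.ne_of_mem_erase hi)]; ring
    rw [ha, ← norm_mul, h1, ← ha, h2]
    have h3 : ‖x j * (C j j : ℂ)‖ = a j * C j j := by
      rw [norm_mul, Complex.norm_real, Real.norm_of_nonneg (q.C_nonneg j j)]
    have h4 : ‖∑ i ∈ Finset.univ.erase j, x i * ((-B i j : ℝ) * y + (C i j : ℂ))‖ ≤
        ∑ i ∈ Finset.univ.erase j, a i * (-B i j + C i j) := by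
      refine (norm_sum_le _ _).trans (Finset.sum_le_sum fun i hi => ?_)
      rw [norm_mul]
      refine mul_le_mul_of_nonneg_left ((norm_add_le _ _).trans ?_) (norm_nonneg _)
      have := q.B_offdiag i j (Finset.ne_of_mem_erase hi)
      rw [norm_mul, hy, Complex.norm_real, Complex.norm_real,
        Real.norm_of_nonneg (q.C_nonneg i j), Real.norm_of_nonneg (by linarith), mul_one]
    refine (norm_add_le _ _).trans ?_
    rw [h3]
    linarith
  have hlow : ∀ j, B j j - A j j ≤ ‖(B j j : ℂ) * y - A j j * y ^ 2‖ := by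
    intro j
    refine le_trans ?_ (norm_sub_norm_le _ _)
    rw [norm_mul, norm_mul, norm_pow, hy, Complex.norm_real, Complex.norm_real,
      Real.norm_of_nonneg (q.A_nonneg j j)]
    have := le_abs_self (B j j)
    simp only [Real.norm_eq_abs]
    linarith
  have ha0 : 0 ≤ a := fun i => norm_nonneg _
  -- The two estimates give a nonnegative vector, and pairing it with `1` gives zero. So `a` is a
  -- positive null vector and equality holds in `key`; an index with `A i i > 0` then forces `y =
  -- 1`.
  have hnonneg : 0 ≤ a ᵥ* (A - B + C) := fun j => by
    have h1 := key j
    have h2 := mul_le_mul_of_nonneg_left (hlow j) (ha0 j)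
    simp only [Pi.zero_apply]
    linarith
  have hzero : a ᵥ* (A - B + C) = 0 := by
    have := eq_zero_of_dotProduct_nonneg (u := (1 : ι → ℝ)) (fun _ => one_pos)
      (neg_nonpos.2 hnonneg)
      (by rw [dotProduct_neg, dotProduct_comm, ← dotProduct_mulVec, q.right]; simp)
    simpa using this
  obtain ⟨i, hi⟩ := q.A_ne_zero
  have hai : 0 < a i := q.pos_of_vecMul_eq_zero ha0 hzero (fun h0 => hx0 (funext fun i =>
    norm_eq_zero.1 (congrFun h0 i))) i
  refine eq_one_of_norm_sub_le hi (q.B_pos hi) hy ?_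
  have := key i
  rw [hzero, Pi.zero_apply, zero_add] at this
  exact le_of_mul_le_mul_left this hai

end Spectrum

/-! ### The left solvent and the d-stable eigenvalues -/

section Solvent

open Polynomial

variable {ι : Type*} [Fintype ι] [DecidableEq ι] {A B C H : Matrix ι ι ℝ} {u : ι → ℝ}

/-- The left solvent `R = C H⁻¹`. -/
def solvent (C H : Matrix ι ι ℝ) : Matrix ι ι ℝ := C * H⁻¹

/-- A fixed point of the functional iteration, in its domain. -/
structure QBDFixed (A B C : Matrix ι ι ℝ) (u : ι → ℝ) (H : Matrix ι ι ℝ) : Prop where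
  qbd : QBD A B C u
  domain : QBDDomain A B C u H
  fixed : qbdStep A B C H = H

namespace QBDFixed

theorem isMMatrix (p : QBDFixed A B C u H) : IsMMatrix H := p.domain.isMMatrix p.qbd

theorem B_eq (p : QBDFixed A B C u H) : B = H + solvent C H * A := by
  conv_rhs => lhs; rw [← p.fixed]
  simp [qbdStep, solvent]

theorem solvent_mul (p : QBDFixed A B C u H) : solvent C H * H = C := by
  rw [solvent, mul_assoc, nonsing_inv_mul _ p.isMMatrix.isUnit_det, mul_one]

theorem solvent_nonneg (p : QBDFixed A B C u H) (i j : ι) : 0 ≤ solvent C H i j :=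
  mul_entry_nonneg p.qbd.C_nonneg p.isMMatrix.inv_nonneg i j

/-- The factorization `(y I - R)(y A - H)` at `y = 1`. -/
theorem rate_eq (p : QBDFixed A B C u H) :
    A - B + C = (1 - solvent C H) * (A - H) := by
  have h1 := p.B_eq
  have h2 := p.solvent_mul
  simp only [sub_mul, mul_sub, one_mul, h2]
  conv_lhs => rw [h1]
  abel

theorem quadPoly_det (p : QBDFixed A B C u H) :
    (quadPoly A (-B) C).det = ((solvent C H).map (algebraMap ℝ ℂ)).charpoly *
      ((X : ℂ[X]) • A.map (fun a => Polynomial.C (a : ℂ)) -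
        H.map (fun a => Polynomial.C (a : ℂ))).det := by
  have hmap : ∀ M N : Matrix ι ι ℝ, (M * N).map (fun a => Polynomial.C (a : ℂ)) =
      M.map (fun a => Polynomial.C (a : ℂ)) * N.map (fun a => Polynomial.C (a : ℂ)) :=
    fun M N => Matrix.map_mul (f := (Polynomial.C (R := ℂ)).comp Complex.ofRealHom)
  have hB : B.map (fun a => Polynomial.C (a : ℂ)) = H.map (fun a => Polynomial.C (a : ℂ)) +
      (solvent C H).map (fun a => Polynomial.C (a : ℂ)) *
        A.map (fun a => Polynomial.C (a : ℂ)) := by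
    rw [← hmap]
    conv_lhs => rw [p.B_eq]
    ext1 i j
    simp
  have hC : C.map (fun a => Polynomial.C (a : ℂ)) =
      (solvent C H).map (fun a => Polynomial.C (a : ℂ)) *
        H.map (fun a => Polynomial.C (a : ℂ)) := by
    rw [← hmap, p.solvent_mul]
  have hQ : quadPoly A (-B) C = (X : ℂ[X]) ^ 2 • A.map (fun a => Polynomial.C (a : ℂ)) -
      (X : ℂ[X]) • B.map (fun a => Polynomial.C (a : ℂ)) +
      C.map (fun a => Polynomial.C (a : ℂ)) := by
    ext1 i j
    simp [quadPoly]
    ring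
  have hR : charmatrix ((solvent C H).map (algebraMap ℝ ℂ)) =
      (X : ℂ[X]) • (1 : Matrix ι ι ℂ[X]) -
        (solvent C H).map (fun a => Polynomial.C (a : ℂ)) := by
    ext1 i j
    simp [charmatrix, Matrix.one_apply, diagonal_apply]
  rw [Matrix.charpoly, ← det_mul, hR, hQ, hB, hC]
  congr 1
  simp only [sub_mul, mul_sub, Matrix.smul_mul, Matrix.mul_smul, one_mul, smul_add, smul_smul,
    pow_two]
  abel

/-- As `H` is nonsingular, `y ≠ 0` and `y⁻¹` is an eigenvalue of the nonnegative matrix `H⁻¹ A`, for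
which `H⁻¹ A 1 ≤ 1`. -/
theorem one_le_norm_of_isRoot (p : QBDFixed A B C u H) {y : ℂ}
    (h : ((X : ℂ[X]) • A.map (fun a => Polynomial.C (a : ℂ)) -
        H.map (fun a => Polynomial.C (a : ℂ))).det.IsRoot y) : 1 ≤ ‖y‖ := by
  have hdet : (y • A.map (algebraMap ℝ ℂ) - H.map (algebraMap ℝ ℂ)).det = 0 := by
    rw [IsRoot, ← coe_evalRingHom, RingHom.map_det] at h
    rw [← h]
    congr 1
    ext i j
    simp
    ring
  have hHu : IsUnit (H.map (algebraMap ℝ ℂ)).det := by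
    have := p.isMMatrix.isUnit_det.map (algebraMap ℝ ℂ)
    rwa [RingHom.map_det] at this
  have hA : A.map (algebraMap ℝ ℂ) = H.map (algebraMap ℝ ℂ) * (H⁻¹ * A).map (algebraMap ℝ ℂ) := by
    rw [← Matrix.map_mul, ← mul_assoc, mul_nonsing_inv _ p.isMMatrix.isUnit_det, one_mul]
  have hdet' : (y • (H⁻¹ * A).map (algebraMap ℝ ℂ) - 1).det = 0 := by
    have : y • A.map (algebraMap ℝ ℂ) - H.map (algebraMap ℝ ℂ) =
        H.map (algebraMap ℝ ℂ) * (y • (H⁻¹ * A).map (algebraMap ℝ ℂ) - 1) := by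
      rw [mul_sub, Matrix.mul_smul, ← hA, mul_one]
    rw [this, det_mul] at hdet
    exact (mul_eq_zero.1 hdet).resolve_left hHu.ne_zero
  have hy : y ≠ 0 := by
    rintro rfl
    simp [det_neg] at hdet'
  have hroot : ((H⁻¹ * A).map (algebraMap ℝ ℂ)).charpoly.IsRoot y⁻¹ := by
    rw [IsRoot, Matrix.eval_charpoly]
    have : scalar ι y⁻¹ - (H⁻¹ * A).map (algebraMap ℝ ℂ) =
        (-y⁻¹) • (y • (H⁻¹ * A).map (algebraMap ℝ ℂ) - 1) := by
      rw [smul_sub, smul_smul, neg_mul, inv_mul_cancel₀ hy, neg_smul, neg_smul, one_smul,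
        sub_neg_eq_add, scalar_apply, ← smul_one_eq_diagonal]
      abel
    rw [this, det_smul, hdet', mul_zero]
  have := norm_le_one_of_isRoot (mul_entry_nonneg p.isMMatrix.inv_nonneg p.qbd.A_nonneg)
    (w := 1) (fun _ => one_pos) (p.domain.inv_mulVec_le p.qbd) hroot
  rw [norm_inv] at this
  exact (inv_le_one₀ (norm_pos_iff.2 hy)).1 this

theorem quadPoly_det_ne_zero (p : QBDFixed A B C u H) : (quadPoly A (-B) C).det ≠ 0 := by
  rw [p.quadPoly_det]
  refine mul_ne_zero (Matrix.charpoly_monic _).ne_zero fun h => ?_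
  have := p.one_le_norm_of_isRoot (y := 0) (by rw [h]; simp [IsRoot])
  simp at this
  linarith

theorem norm_le_one_of_isRoot_solvent (p : QBDFixed A B C u H) {c : ℂ}
    (hc : ((solvent C H).map (algebraMap ℝ ℂ)).charpoly.IsRoot c) : ‖c‖ ≤ 1 := by
  rw [← charpoly_transpose, ← transpose_map] at hc
  refine norm_le_one_of_isRoot (W := (solvent C H)ᵀ) (fun i j => p.solvent_nonneg j i)
    p.qbd.u_pos ?_ hc
  rw [mulVec_transpose]
  exact p.domain.vecMul_inv_le p.qbd

theorem vecMul_solvent (p : QBDFixed A B C u H) (h : u ᵥ* H - u ᵥ* C = 0) :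
    u ᵥ* solvent C H = u := by
  rw [solvent, ← vecMul_vecMul, ← sub_eq_zero.1 h, vecMul_vecMul,
    mul_nonsing_inv _ p.isMMatrix.isUnit_det, vecMul_one]

/-- A left null vector of `I - R` is one of `A - B + C`, hence a multiple of `u`; and `u R = u`
means `u C = u H`. -/
theorem det_one_sub_eq_zero_iff (p : QBDFixed A B C u H) :
    (1 - solvent C H).det = 0 ↔ u ᵥ* H - u ᵥ* C = 0 := by
  constructor
  · intro h
    obtain ⟨x, hx0, hx⟩ := exists_vecMul_eq_zero_iff.2 h
    have hxQ : x ᵥ* (A - B + C) = 0 := by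
      rw [p.rate_eq, ← vecMul_vecMul, hx, zero_vecMul]
    obtain ⟨c, rfl⟩ := p.qbd.eq_smul_of_vecMul_eq_zero hxQ
    have hc : c ≠ 0 := by rintro rfl; simp at hx0
    rw [smul_vecMul, smul_eq_zero, vecMul_sub, vecMul_one, sub_eq_zero] at hx
    have hu := hx.resolve_left hc
    have := congrArg (· ᵥ* H) hu
    simp only [vecMul_vecMul, p.solvent_mul] at this
    rw [this, sub_self]
  · intro h
    refine exists_vecMul_eq_zero_iff.1 ⟨u, ?_, ?_⟩
    · obtain ⟨i, _⟩ := p.qbd.A_ne_zero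
      exact fun h0 => (p.qbd.u_pos i).ne' (congrFun h0 i)
    · rw [vecMul_sub, vecMul_one, p.vecMul_solvent h, sub_self]

theorem limit_nonneg (p : QBDFixed A B C u H) : 0 ≤ u ᵥ* H - u ᵥ* C :=
  sub_nonneg.2 p.domain.left

/-- The drift equals `u (H 1 - A 1) - v̂ 1`, a difference of nonnegative numbers. If `v̂ ≠ 0`, then
`I - R` is invertible, so `(A - H) 1 = 0` and the drift is `-v̂ 1 < 0`. -/
theorem limit_eq_zero_iff (p : QBDFixed A B C u H) :
    u ᵥ* H - u ᵥ* C = 0 ↔ ¬ u ⬝ᵥ ((C - A) *ᵥ 1) < 0 := by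
  have hdrift : u ⬝ᵥ ((C - A) *ᵥ 1) =
      u ⬝ᵥ (H *ᵥ 1 - A *ᵥ 1) - (u ᵥ* H - u ᵥ* C) ⬝ᵥ 1 := by
    rw [sub_mulVec, dotProduct_sub, dotProduct_sub, sub_dotProduct, dotProduct_mulVec u C,
      dotProduct_mulVec u H]
    ring
  constructor
  · intro h
    rw [hdrift, h, zero_dotProduct, sub_zero, not_lt]
    exact dotProduct_nonneg_of p.qbd.u_nonneg (sub_nonneg.2 p.domain.right)
  · intro h
    by_contra hne
    have hunit : IsUnit (1 - solvent C H).det :=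
      isUnit_iff_ne_zero.2 fun h0 => hne (p.det_one_sub_eq_zero_iff.1 h0)
    have h1 : (A - H) *ᵥ 1 = 0 := by
      have := p.qbd.right
      rw [p.rate_eq, ← mulVec_mulVec] at this
      have := congrArg ((1 - solvent C H)⁻¹ *ᵥ ·) this
      simpa only [mulVec_mulVec, ← mul_assoc, nonsing_inv_mul _ hunit, one_mul,
        mulVec_zero] using this
    rw [sub_mulVec, sub_eq_zero] at h1
    rw [hdrift, h1, sub_self, dotProduct_zero, zero_sub, not_lt, neg_nonneg] at h
    refine hne ?_
    have := eq_zero_of_dotProduct_nonneg (u := (1 : ι → ℝ)) (fun _ => one_pos)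
      (neg_nonpos.2 p.limit_nonneg) (by rw [dotProduct_neg, dotProduct_comm]; linarith)
    exact neg_eq_zero.1 this

/-- The eigenvalue `1` of the solvent is simple. -/
theorem rootMultiplicity_le_one (p : QBDFixed A B C u H) :
    (solvent C H).charpoly.rootMultiplicity 1 ≤ 1 := by
  by_cases h0 : u ᵥ* H - u ᵥ* C = 0
  swap
  · have : ¬ (solvent C H).charpoly.IsRoot 1 := by
      rw [IsRoot, Matrix.eval_charpoly]
      simpa using fun h => h0 (p.det_one_sub_eq_zero_iff.1 h)
    rw [rootMultiplicity_eq_zero this]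
    exact zero_le_one
  have huR := p.vecMul_solvent h0
  obtain ⟨w, hw0, hw⟩ := exists_mulVec_eq_zero_iff.2 (p.det_one_sub_eq_zero_iff.2 h0)
  rw [sub_mulVec, one_mulVec, sub_eq_zero] at hw
  -- The triangle inequality gives `|w| ≤ R |w|`; pairing with `u = u R` forces equality.
  have hw' : solvent C H *ᵥ |w| = |w| := by
    have h1 : |w| - solvent C H *ᵥ |w| ≤ 0 := by
      refine sub_nonpos.2 fun i => ?_
      rw [Pi.abs_apply]
      conv_lhs => rw [hw]
      refine (Finset.abs_sum_le_sum_abs _ _).trans (Finset.sum_le_sum fun j _ => ?_)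
      rw [abs_mul, abs_of_nonneg (p.solvent_nonneg i j)]
      rfl
    have := eq_zero_of_dotProduct_nonneg p.qbd.u_pos h1 (by
      rw [dotProduct_sub, dotProduct_mulVec, huR, sub_self])
    exact (sub_eq_zero.1 this).symm
  have hpos : u ⬝ᵥ |w| ≠ 0 := by
    intro h
    have := eq_zero_of_dotProduct_nonneg p.qbd.u_pos (x := -|w|)
      (neg_nonpos.2 (abs_nonneg w)) (by rw [dotProduct_neg, h, neg_zero])
    exact hw0 (by simpa using this)
  -- Pairing `x (R - I) = c u` with `|w|` gives `c = 0`, so there is no Jordan chain above `u`.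
  have hker : ∀ x : ι → ℝ, x ᵥ* (solvent C H - 1) ∈ Submodule.span ℝ {u} →
      x ∈ Submodule.span ℝ {u} := by
    intro x hx
    obtain ⟨c, hc⟩ := Submodule.mem_span_singleton.1 hx
    have h1 : c * (u ⬝ᵥ |w|) = 0 := by
      have := congrArg (· ⬝ᵥ |w|) hc
      simp only [smul_dotProduct, smul_eq_mul] at this
      rw [this, ← dotProduct_mulVec, sub_mulVec, one_mulVec, hw', sub_self, dotProduct_zero]
    have hc0 : c = 0 := (mul_eq_zero.1 h1).resolve_right hpos
    rw [hc0, zero_smul] at hc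
    have : x ᵥ* (A - B + C) = 0 := by
      rw [p.rate_eq, ← vecMul_vecMul, ← neg_sub (solvent C H), vecMul_neg, ← hc, neg_zero,
        zero_vecMul]
    obtain ⟨d, rfl⟩ := p.qbd.eq_smul_of_vecMul_eq_zero this
    exact Submodule.smul_mem _ _ (Submodule.mem_span_singleton_self u)
  set φ : Module.End ℝ (ι → ℝ) := toLin' (solvent C H)ᵀ with hφ
  have hφx : ∀ x, (φ - (1 : ℝ) • (1 : Module.End ℝ (ι → ℝ))) x = x ᵥ* (solvent C H - 1) := by
    intro x
    simp [hφ, toLin'_apply, mulVec_transpose, vecMul_sub]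
  have hle : φ.maxGenEigenspace 1 ≤ Submodule.span ℝ {u} := by
    intro x hx
    obtain ⟨k, hk⟩ := Module.End.mem_maxGenEigenspace _ _ _ |>.1 hx
    induction k generalizing x with
    | zero => simp only [pow_zero, Module.End.one_apply] at hk; rw [hk]; exact zero_mem _
    | succ k ih =>
      refine hker x ?_
      rw [pow_succ, Module.End.mul_apply] at hk
      rw [← hφx]
      exact ih ((Module.End.mem_maxGenEigenspace _ _ _).2 ⟨k, hk⟩) hk
  have hchar : φ.charpoly = (solvent C H).charpoly := by
    rw [hφ, charpoly_toLin', charpoly_transpose]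
  rw [← hchar, ← LinearMap.finrank_maxGenEigenspace_eq]
  exact (Submodule.finrank_mono hle).trans (by simpa using finrank_span_le_card (R := ℝ) {u})

open Classical in
/-- The eigenvalues of the solvent are the d-stable eigenvalues of the polynomial. -/
theorem matEigs_solvent (p : QBDFixed A B C u H) :
    matEigs (solvent C H) = dStableEigs A B C := by
  set m := ((solvent C H).map (algebraMap ℝ ℂ)).charpoly.roots with hm
  have hroot : ∀ {y}, y ∈ m → ((solvent C H).map (algebraMap ℝ ℂ)).charpoly.IsRoot y :=
    fun hy => isRoot_of_mem_roots hy
  have hfilter : (eigs A (-B) C).filter (fun y => ‖y‖ < 1) = m.filter (fun y => ‖y‖ < 1) := by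
    rw [eigs, p.quadPoly_det, roots_mul (p.quadPoly_det ▸ p.quadPoly_det_ne_zero),
      Multiset.filter_add]
    refine add_eq_left.2 (Multiset.filter_eq_nil.2 ?_)
    exact fun y hy => not_lt.2 (p.one_le_norm_of_isRoot (isRoot_of_mem_roots hy))
  -- Eigenvalues of `R` outside the open disc lie on the circle, hence equal `1`.
  have hcirc : m.filter (fun y => ¬ ‖y‖ < 1) = m.filter (Eq 1) := by
    refine Multiset.filter_congr fun y hy => ⟨fun h => ?_, ?_⟩
    · refine (p.qbd.eq_one_of_isRoot
        (le_antisymm (p.norm_le_one_of_isRoot_solvent (hroot hy)) (not_lt.1 h)) ?_).symm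
      rw [p.quadPoly_det, IsRoot, eval_mul, hroot hy, zero_mul]
    · rintro rfl
      simp
  have hcount : m.count 1 = if u ⬝ᵥ ((C - A) *ᵥ 1) < 0 then 0 else 1 := by
    have h1 : m.count 1 = (solvent C H).charpoly.rootMultiplicity 1 := by
      rw [hm, count_roots, charpoly_map,
        eq_rootMultiplicity_map (algebraMap ℝ ℂ).injective (1 : ℝ), map_one]
    have h2 : (solvent C H).charpoly.IsRoot 1 ↔ ¬ u ⬝ᵥ ((C - A) *ᵥ 1) < 0 := by
      rw [← p.limit_eq_zero_iff, ← p.det_one_sub_eq_zero_iff, IsRoot, Matrix.eval_charpoly]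
      simp
    rw [h1]
    split_ifs with h
    · exact rootMultiplicity_eq_zero fun h3 => h2.1 h3 h
    · exact le_antisymm p.rootMultiplicity_le_one
        ((rootMultiplicity_pos (Matrix.charpoly_monic _).ne_zero).2 (h2.2 h))
  rw [dStableEigs, hfilter, matEigs, ← hm]
  conv_lhs => rw [← Multiset.filter_add_not (fun y : ℂ => ‖y‖ < 1) m, hcirc, Multiset.filter_eq,
    hcount]
  simp only [p.qbd.dPositiveRecurrent_iff]
  split_ifs <;> simp

end QBDFixed

end Solvent

/-! ## The invariant pair obtained from the limit of Cyclic Reduction -/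

section Pair

variable {m k : Type*} {A B C H : Matrix (m ⊕ k) (m ⊕ k) ℝ} {u : m ⊕ k → ℝ}

theorem eq_fromBlocks_of_zero (h₁₂ : C.toBlocks₁₂ = 0) (h₂₂ : C.toBlocks₂₂ = 0) :
    C = fromBlocks C.toBlocks₁₁ 0 C.toBlocks₂₁ 0 := by
  conv_lhs => rw [← fromBlocks_toBlocks C, h₁₂, h₂₂]

variable [Fintype m] [Fintype k]

theorem mulVec_eq_elim (H : Matrix (m ⊕ k) (m ⊕ k) ℝ) (x : m → ℝ) (y : k → ℝ) :
    H *ᵥ Sum.elim x y = Sum.elim (H.toBlocks₁₁ *ᵥ x + H.toBlocks₁₂ *ᵥ y)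
      (H.toBlocks₂₁ *ᵥ x + H.toBlocks₂₂ *ᵥ y) := by
  conv_lhs => rw [← fromBlocks_toBlocks H, fromBlocks_mulVec]
  simp

theorem IsMMatrix.toBlocks₁₂_nonpos (hH : IsMMatrix H) (i : m) (j : k) :
    H.toBlocks₁₂ i j ≤ 0 := hH.offdiag _ _ Sum.inl_ne_inr

theorem IsMMatrix.toBlocks₂₁_nonpos (hH : IsMMatrix H) (i : k) (j : m) :
    H.toBlocks₂₁ i j ≤ 0 := hH.offdiag _ _ Sum.inr_ne_inl

theorem IsMMatrix.isMMatrix_toBlocks₂₂ (hH : IsMMatrix H) : IsMMatrix H.toBlocks₂₂ := by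
  refine ⟨fun i j hij => hH.offdiag _ _ (by simpa using hij), fun y hy h => ?_⟩
  have := hH.eq_zero (Sum.elim 0 y) (by rintro (i | i); exacts [le_rfl, hy i]) (by
    rw [mulVec_eq_elim]
    rintro (i | i)
    · have := mulVec_nonneg (M := -H.toBlocks₁₂)
        (fun i j => neg_nonneg.2 (hH.toBlocks₁₂_nonpos i j)) hy i
      simpa [neg_mulVec] using this
    · simpa using h i)
  funext i
  exact congrFun this (Sum.inr i)

variable [DecidableEq k]

theorem IsMMatrix.psi_nonneg (hH : IsMMatrix H) (i : m) (j : k) : 0 ≤ psi H i j :=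
  mul_entry_nonneg (fun i j => neg_nonneg.2 (hH.toBlocks₁₂_nonpos i j))
    hH.isMMatrix_toBlocks₂₂.inv_nonneg i j

theorem IsMMatrix.psi_mul (hH : IsMMatrix H) : psi H * H.toBlocks₂₂ = -H.toBlocks₁₂ := by
  rw [psi, Matrix.mul_assoc, nonsing_inv_mul _ hH.isMMatrix_toBlocks₂₂.isUnit_det,
    Matrix.mul_one]

/-- A test vector `y` for `S` extends to `(y, -B₂₂⁻¹ B₂₁ y)`, which is nonnegative and is mapped by
`H` to `(S y, 0)`. -/
theorem IsMMatrix.isMMatrix_schur (hH : IsMMatrix H) : IsMMatrix (schur H) := by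
  have h21 : ∀ i j, 0 ≤ (-H.toBlocks₂₁) i j := fun i j => neg_nonneg.2 (hH.toBlocks₂₁_nonpos i j)
  refine ⟨fun i j hij => ?_, fun y hy h => ?_⟩
  · have h1 : H.toBlocks₁₁ i j ≤ 0 := hH.offdiag _ _ (by simpa using hij)
    have h2 := mul_entry_nonneg hH.psi_nonneg h21 i j
    rw [Matrix.mul_neg, Matrix.neg_apply] at h2
    rw [schur, Matrix.add_apply]
    linarith
  · have hz : 0 ≤ H.toBlocks₂₂⁻¹ *ᵥ (-H.toBlocks₂₁ *ᵥ y) :=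
      mulVec_nonneg hH.isMMatrix_toBlocks₂₂.inv_nonneg (mulVec_nonneg h21 hy)
    have h2 : H.toBlocks₂₂ *ᵥ (H.toBlocks₂₂⁻¹ *ᵥ (-H.toBlocks₂₁ *ᵥ y)) =
        -H.toBlocks₂₁ *ᵥ y := by
      rw [mulVec_mulVec, mul_nonsing_inv _ hH.isMMatrix_toBlocks₂₂.isUnit_det, one_mulVec]
    have h1 : H.toBlocks₁₁ *ᵥ y + H.toBlocks₁₂ *ᵥ (H.toBlocks₂₂⁻¹ *ᵥ (-H.toBlocks₂₁ *ᵥ y)) =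
        schur H *ᵥ y := by
      simp only [schur, psi, add_mulVec, mulVec_mulVec]
      congr 2
      simp [Matrix.mul_assoc]
    have := hH.eq_zero (Sum.elim y (H.toBlocks₂₂⁻¹ *ᵥ (-H.toBlocks₂₁ *ᵥ y)))
      (by rintro (i | i); exacts [hy i, hz i]) (by
        rw [mulVec_eq_elim, h1, h2]
        rintro (i | i)
        · exact h i
        · simp [neg_mulVec])
    funext i
    exact congrFun this (Sum.inl i)

variable [DecidableEq m]

theorem IsMMatrix.pairU_mul (hH : IsMMatrix H) : pairU H * H = fromCols (schur H) 0 := by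
  have h : pairU H * fromBlocks H.toBlocks₁₁ H.toBlocks₁₂ H.toBlocks₂₁ H.toBlocks₂₂ =
      fromCols (schur H) 0 := by
    rw [pairU, fromCols_mul_fromBlocks, hH.psi_mul, schur]
    simp
  rwa [fromBlocks_toBlocks] at h

theorem IsMMatrix.schur_inv_mul_pairU (hH : IsMMatrix H) :
    (schur H)⁻¹ * pairU H = (fromCols 1 0 : Matrix m (m ⊕ k) ℝ) * H⁻¹ := by
  have h := congrArg (fun M => (schur H)⁻¹ * M * H⁻¹) hH.pairU_mul
  simp only [mul_fromCols, nonsing_inv_mul _ hH.isMMatrix_schur.isUnit_det, Matrix.mul_zero] at h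
  rw [← h, Matrix.mul_assoc, Matrix.mul_assoc, mul_nonsing_inv _ hH.isUnit_det, Matrix.mul_one]

theorem pairY_nonneg (hH : IsMMatrix H) (hC : ∀ i j, 0 ≤ C i j) (i j : m) :
    0 ≤ pairY C H i j := by
  refine mul_entry_nonneg (fun i j => ?_) hH.isMMatrix_schur.inv_nonneg i j
  exact add_nonneg (hC _ _) (mul_entry_nonneg hH.psi_nonneg (fun i j => hC _ _) i j)

theorem pairY_mul_schur (hH : IsMMatrix H) :
    pairY C H * schur H = C.toBlocks₁₁ + psi H * C.toBlocks₂₁ := by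
  rw [pairY, Matrix.mul_assoc, nonsing_inv_mul _ hH.isMMatrix_schur.isUnit_det, Matrix.mul_one]

/-- Left multiplication by `[I Ψ]` clears the second block column of `H`; that of `C` is already
zero, so only the first column has to match. -/
theorem pairY_mul_pairU_mul (hH : IsMMatrix H) (h₁₂ : C.toBlocks₁₂ = 0)
    (h₂₂ : C.toBlocks₂₂ = 0) : pairY C H * (pairU H * H) = pairU H * C := by
  rw [hH.pairU_mul, mul_fromCols, pairY_mul_schur hH]
  conv_rhs => rw [eq_fromBlocks_of_zero h₁₂ h₂₂, pairU, fromCols_mul_fromBlocks]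
  simp

theorem pairY_mul_pairU (hH : IsMMatrix H) (h₁₂ : C.toBlocks₁₂ = 0)
    (h₂₂ : C.toBlocks₂₂ = 0) : pairY C H * pairU H = pairU H * solvent C H := by
  rw [solvent, ← Matrix.mul_assoc, ← pairY_mul_pairU_mul hH h₁₂ h₂₂, Matrix.mul_assoc,
    Matrix.mul_assoc, mul_nonsing_inv _ hH.isUnit_det, Matrix.mul_one]

theorem rank_fromCols_pairU (Z : Matrix m (m ⊕ k) ℝ) :
    (fromCols (pairU H) Z).rank = Fintype.card m := by
  refine le_antisymm (rank_le_card_height _) ?_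
  have h : fromCols (pairU H) Z *
      fromRows (fromRows (1 : Matrix m m ℝ) (0 : Matrix k m ℝ)) (0 : Matrix (m ⊕ k) m ℝ) = 1 := by
    rw [fromCols_mul_fromRows, pairU, fromCols_mul_fromRows]
    simp
  rw [← rank_one (R := ℝ) (n := m), ← h]
  exact rank_mul_le_left _ _

/-- Since `Y U = U R`, completing `U = [I Ψ]` to the unipotent matrix `T` makes `T R T⁻¹` block
lower triangular with diagonal blocks `Y` and `0`. -/
theorem matEigs_solvent_eq (hH : IsMMatrix H) (h₁₂ : C.toBlocks₁₂ = 0)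
    (h₂₂ : C.toBlocks₂₂ = 0) :
    matEigs (solvent C H) = matEigs (pairY C H) + Multiset.replicate (Fintype.card k) 0 := by
  set T : Matrix (m ⊕ k) (m ⊕ k) ℝ := fromBlocks 1 (psi H) 0 1 with hT
  set N : Matrix (m ⊕ k) (m ⊕ k) ℝ :=
    fromBlocks (pairY C H) 0 (C.toBlocks₂₁ * (schur H)⁻¹) 0 with hN
  have hTu : IsUnit T.det := by rw [hT, det_fromBlocks_zero₂₁]; simp
  have hTN : T * solvent C H = N * T := by
    have hT' : T = fromRows (pairU H) (fromCols 0 1) := by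
      rw [pairU, fromRows_fromCols_eq_fromBlocks]
    have hN' : N = fromRows (fromCols (pairY C H) 0) (fromCols (C.toBlocks₂₁ * (schur H)⁻¹) 0) := by
      rw [fromRows_fromCols_eq_fromBlocks]
    have h1 : (fromCols 0 1 : Matrix k (m ⊕ k) ℝ) * solvent C H = C.toBlocks₂₁ * ((schur H)⁻¹ * pairU H) := by
      rw [hH.schur_inv_mul_pairU, solvent, ← Matrix.mul_assoc, ← Matrix.mul_assoc]
      congr 1
      rw [mul_fromCols]
      conv_lhs => rw [eq_fromBlocks_of_zero h₁₂ h₂₂, fromCols_mul_fromBlocks]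
      simp
    rw [hT', hN', fromRows_mul, fromRows_mul, fromCols_mul_fromRows, fromCols_mul_fromRows,
      ← pairY_mul_pairU hH h₁₂ h₂₂, h1]
    simp [Matrix.mul_assoc]
  have hchar : (solvent C H).charpoly = N.charpoly := by
    have : solvent C H = T⁻¹ * (N * T) := by
      rw [← hTN, ← mul_assoc, nonsing_inv_mul _ hTu, one_mul]
    rw [this, charpoly_mul_comm, mul_assoc, mul_nonsing_inv _ hTu, mul_one]
  rw [matEigs, matEigs, charpoly_map, charpoly_map, hchar, hN, charpoly_fromBlocks_zero₁₂,
    charpoly_zero, Polynomial.map_mul, Polynomial.roots_mul]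
  · simp [Multiset.nsmul_singleton]
  · exact mul_ne_zero ((charpoly_monic _).map _).ne_zero
      ((Polynomial.monic_X_pow _).map _).ne_zero

theorem QBDFixed.isDStablePairDeflating (p : QBDFixed A B C u H) (h₁₂ : C.toBlocks₁₂ = 0)
    (h₂₂ : C.toBlocks₂₂ = 0) :
    IsDStablePairDeflating (Fintype.card k) A B C (pairY C H) (pairU H) := by
  have hH := p.isMMatrix
  refine ⟨p.quadPoly_det_ne_zero, ⟨?_, rank_fromCols_pairU _⟩, ?_⟩
  · have h1 := pairY_mul_pairU_mul hH h₁₂ h₂₂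
    have h2 : pairY C H * pairU H * B = pairY C H * (pairU H * H) + pairY C H ^ 2 * pairU H * A := by
      conv_lhs => rw [p.B_eq]
      have h3 : pairY C H * pairU H * (solvent C H * A) = pairY C H ^ 2 * pairU H * A := by
        rw [← Matrix.mul_assoc, Matrix.mul_assoc (pairY C H), ← pairY_mul_pairU hH h₁₂ h₂₂,
          ← Matrix.mul_assoc, pow_two]
      rw [Matrix.mul_add, h3, Matrix.mul_assoc]
    rw [Matrix.mul_neg, h2, h1]
    abel
  · rw [← matEigs_solvent_eq hH h₁₂ h₂₂, p.matEigs_solvent]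

end Pair

/-! ### The shifted and discretized model as a quasi-birth-death polynomial -/

section ModelQBD

variable {m k : Type*} {v d u : m ⊕ k → ℝ} {Q : Matrix (m ⊕ k) (m ⊕ k) ℝ} {h : ℝ}

theorem IsModel.eq_empty_or_univ {ι : Type*} [Fintype ι] {v d : ι → ℝ} {Q : Matrix ι ι ℝ}
    (hM : IsModel v d Q) (S : Set ι) (hS : ∀ i, i ∉ S → ∀ j ∈ S, Q i j = 0) :
    S = ∅ ∨ S = Set.univ := by
  rcases S.eq_empty_or_nonempty with h | ⟨j, hj⟩
  · exact Or.inl h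
  · refine Or.inr (Set.eq_univ_of_forall fun i => ?_)
    induction hM.irreducible i j using Relation.ReflTransGen.head_induction_on with
    | refl => exact hj
    | head hab _ ih => exact by_contra fun h => hab (hS _ h _ ih)

theorem IsModel.diag_nonpos {ι : Type*} [Fintype ι] {v d : ι → ℝ} {Q : Matrix ι ι ℝ}
    (hM : IsModel v d Q) (i : ι) : Q i i ≤ 0 := by
  classical
  have h1 : ∑ j, Q i j = 0 := by simpa [mulVec, dotProduct] using congrFun hM.row_sum i
  rw [← Finset.add_sum_erase _ _ (Finset.mem_univ i)] at h1
  have : 0 ≤ ∑ j ∈ Finset.univ.erase i, Q i j := Finset.sum_nonneg fun j hj =>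
    hM.offdiag_nonneg i j (Finset.ne_of_mem_erase hj).symm
  linarith

section

variable [DecidableEq m] [DecidableEq k]

/-- The point `y = 1` corresponds to `z = 0`, where the column scaling is trivial and `P` equals
`Q`. -/
theorem tilde_rate (v d : m ⊕ k → ℝ) (Q : Matrix (m ⊕ k) (m ⊕ k) ℝ) (h : ℝ) :
    tildeA v d h - tildeB v d Q h + tildeC v d Q h = Q := by
  ext i j
  rcases i with i | i <;> rcases j with j | j
  · by_cases hij : i = j
    · subst hij; simp [tildeA, tildeB, tildeC, toBlocks₁₁]; ring
    · simp [tildeA, tildeB, tildeC, toBlocks₁₁, hij]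
  · simp [tildeA, tildeB, tildeC, toBlocks₁₂]
  · simp [tildeA, tildeB, tildeC, toBlocks₂₁]
  · by_cases hij : i = j
    · subst hij; simp [tildeA, tildeB, tildeC, toBlocks₂₂]
    · simp [tildeA, tildeB, tildeC, toBlocks₂₂, hij]

end

variable [Fintype m] [Fintype k]

/-- The standing assumptions on the data. -/
structure IsData (v d : m ⊕ k → ℝ) (Q : Matrix (m ⊕ k) (m ⊕ k) ℝ) (u : m ⊕ k → ℝ)
    (h : ℝ) : Prop where
  model : IsModel v d Q
  mem_right : ∀ i : m ⊕ k, (v i = 0 ∧ d i < 0) ↔ i.isRight = true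
  u_pos : ∀ i, 0 < u i
  u_mul : u ᵥ* Q = 0
  h_pos : 0 < h
  small : ∀ i : m,
    0 ≤ (h ^ 2)⁻¹ * v (Sum.inl i) + h⁻¹ * d (Sum.inl i) + Q (Sum.inl i) (Sum.inl i)

/-- Needed for letting the step tend to zero. As `Q i i ≤ 0`, admissibility of `h` gives `h⁻¹ v + d
≥ 0`, so `s (s v + d)` does not decrease as `s` grows from `h⁻¹`. -/
theorem IsData.of_le (D : IsData v d Q u h) {t : ℝ} (ht : 0 < t) (hth : t ≤ h) :
    IsData v d Q u t := by
  refine { D with h_pos := ht, small := fun i => ?_ }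
  have h1 := D.small i
  have hv := D.model.v_nonneg (Sum.inl i)
  have hq := D.model.diag_nonpos (Sum.inl i)
  have hs : 0 < h⁻¹ := inv_pos.2 D.h_pos
  have hst : h⁻¹ ≤ t⁻¹ := inv_anti₀ ht hth
  rw [← inv_pow] at h1 ⊢
  have h2 : 0 ≤ h⁻¹ * v (Sum.inl i) + d (Sum.inl i) := by
    refine nonneg_of_mul_nonneg_right (a := h⁻¹) ?_ hs
    linarith
  have h3 := mul_le_mul_of_nonneg_right hst h2
  have h4 := mul_nonneg (hs.le.trans hst) (mul_nonneg (sub_nonneg.2 hst) hv)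
  linarith

variable [DecidableEq m] [DecidableEq k]

theorem IsData.qbd (D : IsData v d Q u h) :
    QBD (tildeA v d h) (tildeB v d Q h) (tildeC v d Q h) u where
  A_nonneg i j := by
    have hv := D.model.v_nonneg
    have hh := D.h_pos
    rcases i with i | i <;> rcases j with j | j
    · by_cases hij : i = j
      · subst hij
        have := hv (Sum.inl i)
        simp only [tildeA, fromBlocks_apply₁₁, diagonal_apply_eq]
        positivity
      · simp [tildeA, hij]
    · simp [tildeA]
    · simp [tildeA]
    · by_cases hij : i = j
      · subst hij
        have := ((D.mem_right (Sum.inr i)).2 rfl).2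
        simp only [tildeA, fromBlocks_apply₂₂, diagonal_apply_eq, Left.nonneg_neg_iff]
        exact mul_nonpos_of_nonneg_of_nonpos (by positivity) this.le
      · simp [tildeA, hij]
  A_diag i j hij := by
    rcases i with i | i <;> rcases j with j | j <;> simp_all [tildeA]
  A_ne_zero := by
    obtain ⟨i, hi⟩ := D.model.v_ne_zero
    have hh := D.h_pos
    rcases i with i | i
    · refine ⟨Sum.inl i, ?_⟩
      have : 0 < v (Sum.inl i) := lt_of_le_of_ne (D.model.v_nonneg _) hi.symm
      simp only [tildeA, fromBlocks_apply₁₁, diagonal_apply_eq]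
      positivity
    · exact absurd ((D.mem_right (Sum.inr i)).2 rfl).1 hi
  C_nonneg i j := by
    have ho := D.model.offdiag_nonneg
    rcases i with i | i <;> rcases j with j | j
    · by_cases hij : i = j
      · subst hij
        simpa [tildeC, toBlocks₁₁] using D.small i
      · simpa [tildeC, toBlocks₁₁, hij] using ho _ _ (by simpa using hij)
    · simp [tildeC]
    · simpa [tildeC, toBlocks₂₁] using ho _ _ Sum.inr_ne_inl
    · simp [tildeC]
  B_offdiag i j hij := by
    have ho := D.model.offdiag_nonneg i j hij
    rcases i with i | i <;> rcases j with j | j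
    · have : i ≠ j := by simpa using hij
      simp [tildeB, this]
    · simpa [tildeB, toBlocks₁₂] using ho
    · simp [tildeB]
    · have : i ≠ j := by simpa using hij
      simpa [tildeB, toBlocks₂₂, this] using ho
  u_pos := D.u_pos
  left := by rw [tilde_rate]; exact D.u_mul
  right := by rw [tilde_rate]; exact D.model.row_sum
  irred := by rw [tilde_rate]; exact D.model.eq_empty_or_univ

/-- The vectors `(C̃ - Ã) 1` and `h⁻¹ D 1` differ by an element of the range of `Q`, which the
Perron vector annihilates. -/
theorem dPositiveRecurrent_tilde_iff (hh : 0 < h) :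
    DPositiveRecurrent (tildeA v d h) (tildeB v d Q h) (tildeC v d Q h) ↔
      CPositiveRecurrent (diagonal d) Q := by
  have key : (tildeC v d Q h - tildeA v d h) *ᵥ 1 =
      h⁻¹ • (diagonal d *ᵥ 1) + Q *ᵥ Sum.elim 1 0 := by
    funext i
    rcases i with i | i
    · simp [mulVec, dotProduct, tildeC, tildeA, diagonal_apply, toBlocks₁₁,
        Finset.sum_add_distrib]
      ring
    · simp [mulVec, dotProduct, tildeC, tildeA, diagonal_apply, toBlocks₂₁]
      ring
  unfold DPositiveRecurrent CPositiveRecurrent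
  rw [tilde_rate, key]
  refine exists_congr fun w => and_congr_right fun _ => and_congr_right fun hw => ?_
  rw [dotProduct_add, dotProduct_mulVec w Q, hw, zero_dotProduct, add_zero, dotProduct_smul,
    smul_eq_mul]
  exact ⟨fun h0 => (pos_iff_neg_of_mul_neg h0).1 (inv_pos.2 hh),
    mul_neg_of_pos_of_neg (inv_pos.2 hh)⟩

open Polynomial in
-- In fact `F̃(y) = P((y - 1) / h) diag(I, y I)`, the scaling acting on the columns of `E₃`.
theorem quadPoly_tilde_det (hh : h ≠ 0) (hv : ∀ j : k, v (Sum.inr j) = 0) :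
    (quadPoly (tildeA v d h) (-tildeB v d Q h) (tildeC v d Q h)).det =
      X ^ Fintype.card k * (quadPoly (diagonal v) (-diagonal d) Q).det.comp
        (C (h : ℂ)⁻¹ * X + C (-(h : ℂ)⁻¹)) := by
  refine Polynomial.funext fun y => ?_
  rw [eval_mul, eval_comp, eval_det_quadPoly, eval_det_quadPoly]
  set z : ℂ := eval y (C (h : ℂ)⁻¹ * X + C (-(h : ℂ)⁻¹)) with hz
  have hz' : z = (h : ℂ)⁻¹ * (y - 1) := by simp [hz]; ring
  have hdet : (diagonal (Sum.elim (fun _ : m => (1 : ℂ)) (fun _ : k => y))).det =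
      y ^ Fintype.card k := by
    simp [det_diagonal]
  rw [eval_pow, eval_X, ← hdet, mul_comm, ← det_mul]
  congr 1
  ext i j
  rw [mul_diagonal]
  have hh' : (h : ℂ) ≠ 0 := by exact_mod_cast hh
  rcases i with i | i <;> rcases j with j | j
  · by_cases hij : i = j
    · subst hij
      simp [tildeA, tildeB, tildeC, toBlocks₁₁, hz']; field_simp; ring
    · simp [tildeA, tildeB, tildeC, toBlocks₁₁, hij]
  · simp [tildeA, tildeB, tildeC, toBlocks₁₂]
  · simp [tildeA, tildeB, tildeC, toBlocks₂₁]
  · by_cases hij : i = j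
    · subst hij
      simp [tildeA, tildeB, tildeC, toBlocks₂₂, hz', hv]; ring
    · simp [tildeA, tildeB, tildeC, toBlocks₂₂, hij]

end ModelQBD

/-! ### Transfer to continuous time -/

section CStable

variable {m k : Type*} {v d u : m ⊕ k → ℝ} {Q H : Matrix (m ⊕ k) (m ⊕ k) ℝ} {h : ℝ}

theorem tildeC_toBlocks₁₂ [DecidableEq m] (v d : m ⊕ k → ℝ) (Q : Matrix (m ⊕ k) (m ⊕ k) ℝ) (h : ℝ) :
    (tildeC v d Q h).toBlocks₁₂ = 0 :=
  toBlocks_fromBlocks₁₂ ..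

theorem tildeC_toBlocks₂₂ [DecidableEq m] (v d : m ⊕ k → ℝ) (Q : Matrix (m ⊕ k) (m ⊕ k) ℝ) (h : ℝ) :
    (tildeC v d Q h).toBlocks₂₂ = 0 := toBlocks_fromBlocks₂₂ ..

variable [Fintype m] [Fintype k]

theorem IsData.v_inr (D : IsData v d Q u h) (j : k) : v (Sum.inr j) = 0 :=
  ((D.mem_right (Sum.inr j)).2 rfl).1

variable [DecidableEq m] [DecidableEq k]

/-- The limit of Cyclic Reduction for the model. -/
abbrev IsLimit (v d : m ⊕ k → ℝ) (Q : Matrix (m ⊕ k) (m ⊕ k) ℝ) (u : m ⊕ k → ℝ) (h : ℝ)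
    (H : Matrix (m ⊕ k) (m ⊕ k) ℝ) : Prop :=
  QBDFixed (tildeA v d h) (tildeB v d Q h) (tildeC v d Q h) u H

open Polynomial in
theorem matEigs_smul_sub_one (Y : Matrix m m ℝ) (hh : h ≠ 0) :
    matEigs Y = (matEigs (h⁻¹ • (Y - 1))).map fun z => (h : ℂ) * z + 1 := by
  have hh' : (h : ℂ) ≠ 0 := by exact_mod_cast hh
  have key : (Y.map (algebraMap ℝ ℂ)).charpoly.comp (C (h : ℂ) * X + C 1) =
      C ((h : ℂ) ^ Fintype.card m) * ((h⁻¹ • (Y - 1)).map (algebraMap ℝ ℂ)).charpoly := by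
    refine Polynomial.funext fun y => ?_
    rw [eval_comp, eval_mul, eval_C, Matrix.eval_charpoly, Matrix.eval_charpoly, ← det_smul]
    congr 1
    ext i j
    by_cases hij : i = j
    · subst hij; simp; field_simp; ring
    · simp [hij, mul_inv_cancel_left₀ hh']
  have := map_roots_comp_C_mul_X_add_C (Y.map (algebraMap ℝ ℂ)).charpoly (h : ℂ) 1
    (isUnit_iff_ne_zero.2 hh')
  rw [key, roots_C_mul _ (pow_ne_zero _ hh')] at this
  exact this.symm

theorem card_matEigs (Y : Matrix m m ℝ) : (matEigs Y).card = Fintype.card m := by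
  rw [matEigs, IsAlgClosed.card_roots_eq_natDegree, charpoly_natDegree_eq_dim]

open Polynomial in
theorem IsData.eigs_tilde (D : IsData v d Q u h)
    (h0 : (quadPoly (tildeA v d h) (-tildeB v d Q h) (tildeC v d Q h)).det ≠ 0) :
    eigs (tildeA v d h) (-tildeB v d Q h) (tildeC v d Q h) =
      Multiset.replicate (Fintype.card k) 0 +
        (eigs (diagonal v) (-diagonal d) Q).map fun z => (h : ℂ) * z + 1 := by
  have hh' : (h : ℂ) ≠ 0 := by exact_mod_cast D.h_pos.ne'
  have hF := quadPoly_tilde_det (v := v) (d := d) (Q := Q) D.h_pos.ne' D.v_inr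
  rw [hF] at h0
  rw [eigs, hF, roots_mul h0, roots_pow, roots_X, Multiset.nsmul_singleton,
    roots_comp_C_mul_X_add_C _ _ _ (isUnit_iff_ne_zero.2 (inv_ne_zero hh')), eigs]
  congr 1
  refine Multiset.map_congr rfl fun z _ => ?_
  simp [Ring.inverse_eq_inv', mul_add, hh']

theorem IsLimit.isRegular (p : IsLimit v d Q u h H) (D : IsData v d Q u h) :
    IsRegular (diagonal v) (-diagonal d) Q := by
  intro h0
  refine p.quadPoly_det_ne_zero ?_
  rw [quadPoly_tilde_det D.h_pos.ne' D.v_inr, h0]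
  simp

open Classical in
-- Compared after the injective map `z ↦ h z + 1`: the `n₃` zeros produced by the column scaling lie
-- in the open disc and cancel against the deflated ones.
theorem IsLimit.matEigs_pairX (p : IsLimit v d Q u h H) (D : IsData v d Q u h) :
    matEigs (pairX (tildeC v d Q h) H h) =
      (eigs (diagonal v) (-diagonal d) Q).filter (fun z => ‖(h : ℂ) * z + 1‖ < 1) +
        (if CPositiveRecurrent (diagonal d) Q then 0 else {0}) := by
  have hh' : (h : ℂ) ≠ 0 := by exact_mod_cast D.h_pos.ne'
  have hinj : Function.Injective fun z : ℂ => (h : ℂ) * z + 1 := fun a b hab =>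
    mul_left_cancel₀ hh' (add_right_cancel hab)
  refine Multiset.map_injective hinj ?_
  have h1 := (p.isDStablePairDeflating (tildeC_toBlocks₁₂ v d Q h)
    (tildeC_toBlocks₂₂ v d Q h)).2.2
  rw [dStableEigs, D.eigs_tilde p.quadPoly_det_ne_zero, Multiset.filter_add,
    Multiset.filter_eq_self.2 (by
      intro a ha; rw [Multiset.eq_of_mem_replicate ha]; simp), add_assoc, add_comm] at h1
  have h2 := add_left_cancel h1
  rw [pairX, ← matEigs_smul_sub_one _ D.h_pos.ne', h2, Multiset.filter_map, Multiset.map_add]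
  simp only [dPositiveRecurrent_tilde_iff D.h_pos]
  congr 1
  split_ifs <;> simp

open Classical in
-- Both sides count the eigenvalues of `X`. Consequently the number of eigenvalues of `P` in the
-- disc does not depend on `h`.
theorem IsData.card_filter (D : IsData v d Q u h) :
    ((eigs (diagonal v) (-diagonal d) Q).filter (fun z => ‖(h : ℂ) * z + 1‖ < 1)).card +
      (if CPositiveRecurrent (diagonal d) Q then 0 else {0} : Multiset ℂ).card =
        Fintype.card m := by
  obtain ⟨H, hH, hfix, _⟩ := D.qbd.exists_limit
  have p : IsLimit v d Q u h H := ⟨D.qbd, hH, hfix⟩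
  rw [← Multiset.card_add, ← p.matEigs_pairX D, card_matEigs]

theorem re_neg_of_norm_lt_one {h : ℝ} (hh : 0 < h) {z : ℂ} (hz : ‖(h : ℂ) * z + 1‖ < 1) :
    z.re < 0 := by
  have h1 := (Complex.re_le_norm ((h : ℂ) * z + 1)).trans_lt hz
  simp at h1
  exact (pos_iff_neg_of_mul_neg h1).1 hh

theorem eventually_norm_lt_one {z : ℂ} (hz : z.re < 0) :
    ∀ᶠ t : ℝ in 𝓝[>] 0, ‖(t : ℂ) * z + 1‖ < 1 := by
  have h1 : ∀ᶠ t : ℝ in 𝓝[>] 0, t * Complex.normSq z < -2 * z.re := by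
    have : Tendsto (fun t : ℝ => t * Complex.normSq z) (𝓝[>] 0) (𝓝 (0 * Complex.normSq z)) :=
      ((continuous_id.mul continuous_const).tendsto 0).mono_left nhdsWithin_le_nhds
    exact this.eventually_lt_const (by linarith)
  filter_upwards [h1, self_mem_nhdsWithin] with t ht ht0
  have ht0' : 0 < t := ht0
  rw [← sq_lt_one_iff₀ (norm_nonneg _), ← Complex.normSq_eq_norm_sq, Complex.normSq_apply]
  rw [Complex.normSq_apply] at ht
  have := mul_lt_mul_of_pos_left ht ht0'
  simp
  linarith

open Classical in
-- The disc lies in the left half-plane, so it suffices to compare cardinalities. For a small step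
-- `t ≤ h` the disc contains the finitely many eigenvalues with negative real part, and its count is
-- the same for `t` and `h`.
theorem IsData.filter_eq (D : IsData v d Q u h) :
    (eigs (diagonal v) (-diagonal d) Q).filter (fun z => ‖(h : ℂ) * z + 1‖ < 1) =
      (eigs (diagonal v) (-diagonal d) Q).filter (fun z => z.re < 0) := by
  set E := eigs (diagonal v) (-diagonal d) Q with hE
  have hev : ∀ᶠ t : ℝ in 𝓝[>] 0, ∀ z ∈ E.toFinset, z.re < 0 → ‖(t : ℂ) * z + 1‖ < 1 := by
    rw [Filter.eventually_all_finset]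
    intro z _
    by_cases hz : z.re < 0
    · filter_upwards [eventually_norm_lt_one hz] with t ht _ using ht
    · exact Eventually.of_forall fun t h => absurd h hz
  obtain ⟨t, ht, ht0⟩ := (hev.and (Ioc_mem_nhdsGT D.h_pos)).exists
  have h1 : E.filter (fun z => ‖(t : ℂ) * z + 1‖ < 1) = E.filter (fun z => z.re < 0) :=
    Multiset.filter_congr fun z hz =>
      ⟨re_neg_of_norm_lt_one ht0.1, ht z (Multiset.mem_toFinset.2 hz)⟩
  have h2 := (D.of_le ht0.1 ht0.2).card_filter
  rw [← D.card_filter, ← hE, h1] at h2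
  exact Multiset.eq_of_le_of_card_le
    (Multiset.monotone_filter_right _ fun z => re_neg_of_norm_lt_one D.h_pos)
    (Nat.add_right_cancel h2).le

/-- On `E₁ ∪ E₂` the relation is that for `F̃`. On `E₃` the latter carries an extra left factor `Y`,
and cancelling it would require `Y` nonsingular; the second block column of `U B̃ = U H + Y U Ã`,
where `U H = [S 0]`, gives the relation directly. -/
theorem IsLimit.leftInvariant (p : IsLimit v d Q u h H) (D : IsData v d Q u h) :
    pairU H * Q + pairX (tildeC v d Q h) H h * pairU H * -diagonal d +
      pairX (tildeC v d Q h) H h ^ 2 * pairU H * diagonal v = 0 := by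
  set Y := pairY (tildeC v d Q h) H with hY
  have hH := p.isMMatrix
  have hdiag : ∀ w : m ⊕ k → ℝ, diagonal w =
      fromBlocks (diagonal fun i => w (Sum.inl i)) 0 0 (diagonal fun j => w (Sum.inr j)) := by
    intro w
    rw [fromBlocks_diagonal]
    congr 1; funext i; cases i <;> rfl
  have hv0 : (diagonal fun j : k => v (Sum.inr j)) = 0 := by
    ext i j; simp [diagonal_apply, D.v_inr]
  have hF := (p.isDStablePairDeflating (tildeC_toBlocks₁₂ v d Q h)
    (tildeC_toBlocks₂₂ v d Q h)).2.1.1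
  have hUB : pairU H * tildeB v d Q h = pairU H * H + Y * pairU H * tildeA v d h := by
    conv_lhs => rw [p.B_eq]
    rw [Matrix.mul_add, ← Matrix.mul_assoc, ← pairY_mul_pairU hH (tildeC_toBlocks₁₂ v d Q h)
      (tildeC_toBlocks₂₂ v d Q h)]
  rw [hH.pairU_mul] at hUB
  rw [← hY] at hF
  have eA : (diagonal fun i : m => (h ^ 2)⁻¹ * v (Sum.inl i)) =
      (h⁻¹ ^ 2) • diagonal fun i : m => v (Sum.inl i) := by
    rw [← diagonal_smul]; simp [Pi.smul_def]
  have eA₃ : (diagonal fun j : k => -(h⁻¹ * d (Sum.inr j))) =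
      -(h⁻¹ • diagonal fun j : k => d (Sum.inr j)) := by
    rw [← diagonal_smul, diagonal_neg]; rfl
  have eB : (diagonal fun i : m => 2 * (h ^ 2)⁻¹ * v (Sum.inl i) + h⁻¹ * d (Sum.inl i)) =
      (2 * h⁻¹ ^ 2) • (diagonal fun i : m => v (Sum.inl i)) +
        h⁻¹ • diagonal fun i : m => d (Sum.inl i) := by
    rw [← diagonal_smul, ← diagonal_smul, diagonal_add]; simp
  have eC : (diagonal fun i : m => (h ^ 2)⁻¹ * v (Sum.inl i) + h⁻¹ * d (Sum.inl i)) =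
      (h⁻¹ ^ 2) • (diagonal fun i : m => v (Sum.inl i)) +
        h⁻¹ • diagonal fun i : m => d (Sum.inl i) := by
    rw [← diagonal_smul, ← diagonal_smul, diagonal_add]; simp
  rw [tildeA, tildeB, tildeC, eA, eB, eC, eA₃] at hF
  rw [tildeA, tildeB, eA, eB, eA₃] at hUB
  set V₁ := diagonal fun i : m => v (Sum.inl i)
  set D₁ := diagonal fun i : m => d (Sum.inl i)
  set D₃ := diagonal fun j : k => d (Sum.inr j)
  have hadd : ∀ (a c : Matrix m m ℝ) (b e : Matrix m k ℝ),
      fromCols a b + fromCols c e = fromCols (a + c) (b + e) := by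
    intro a c b e; ext i (j | j) <;> rfl
  have hdV : (diagonal fun i : m => v (Sum.inl i)) = V₁ := rfl
  have hdD : (diagonal fun i : m => d (Sum.inl i)) = D₁ := rfl
  have hdD₃ : (diagonal fun j : k => d (Sum.inr j)) = D₃ := rfl
  rw [pairX, ← hY, hdiag v, hdiag d, hv0, hdV, hdD, hdD₃]
  conv_lhs => rw [← fromBlocks_toBlocks Q]
  simp only [pairU, fromBlocks_neg, fromCols_mul_fromBlocks, mul_fromCols, hadd] at hF hUB ⊢
  rw [← fromCols_zero] at hF ⊢
  rw [fromCols_ext_iff] at hF hUB ⊢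
  have h1 := hF.1
  have h2 := hUB.2
  clear hF hUB
  simp only [Matrix.mul_one, Matrix.one_mul, Matrix.mul_zero, Matrix.mul_neg, Matrix.mul_add,
    Matrix.mul_sub, Matrix.mul_smul, Matrix.smul_mul, Matrix.sub_mul, pow_two, neg_zero,
    add_zero, zero_add] at h1 h2 ⊢
  refine ⟨?_, ?_⟩
  · rw [← h1]
    module
  · rw [← sub_eq_zero] at h2
    rw [← neg_eq_zero, ← h2]
    module

theorem IsLimit.isCStablePair (p : IsLimit v d Q u h H) (D : IsData v d Q u h) :
    IsCStablePair (diagonal v) (diagonal d) Q (pairX (tildeC v d Q h) H h) (pairU H) :=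
  ⟨p.isRegular D, ⟨p.leftInvariant D, rank_fromCols_pairU _⟩, by
    rw [p.matEigs_pairX D, D.filter_eq, cStableEigs]⟩

end CStable

/-! ## Subtraction-free computation -/

section SubtractionFree

variable {Θ σ : Type*} {x : Θ → σ → ℝ}

/-- The function `f` of the parameter `θ` is given by one expression in the variables `x θ`,
which is subtraction-free for all `θ`. -/
def SubtractionFree (x : Θ → σ → ℝ) (f : Θ → ℝ) : Prop :=
  ∃ e : Expr σ, ∀ θ, e.SubtractionFreeAt (x θ) ∧ e.eval (x θ) = f θ

namespace SubtractionFree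

variable {f g : Θ → ℝ}

theorem var (s : σ) : SubtractionFree x fun θ => x θ s := ⟨.var s, fun _ => ⟨trivial, rfl⟩⟩

theorem zero : SubtractionFree x fun _ => 0 := ⟨.zero, fun _ => ⟨trivial, rfl⟩⟩

theorem one : SubtractionFree x fun _ => 1 := ⟨.one, fun _ => ⟨trivial, rfl⟩⟩

theorem neg (hf : SubtractionFree x f) : SubtractionFree x fun θ => -f θ := by
  obtain ⟨e, he⟩ := hf
  exact ⟨.neg e, fun θ => ⟨(he θ).1, by rw [Expr.eval, (he θ).2]⟩⟩

theorem add (hf : SubtractionFree x f) (hg : SubtractionFree x g) (h0 : ∀ θ, 0 ≤ f θ)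
    (h1 : ∀ θ, 0 ≤ g θ) : SubtractionFree x fun θ => f θ + g θ := by
  obtain ⟨e, he⟩ := hf
  obtain ⟨e', he'⟩ := hg
  refine ⟨.add e e', fun θ => ⟨⟨(he θ).1, (he' θ).1, ?_⟩, ?_⟩⟩
  · rw [(he θ).2, (he' θ).2]; exact mul_nonneg (h0 θ) (h1 θ)
  · rw [Expr.eval, (he θ).2, (he' θ).2]

theorem mul (hf : SubtractionFree x f) (hg : SubtractionFree x g) :
    SubtractionFree x fun θ => f θ * g θ := by
  obtain ⟨e, he⟩ := hf
  obtain ⟨e', he'⟩ := hg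
  exact ⟨.mul e e', fun θ => ⟨⟨(he θ).1, (he' θ).1⟩, by rw [Expr.eval, (he θ).2, (he' θ).2]⟩⟩

theorem div (hf : SubtractionFree x f) (hg : SubtractionFree x g) (h : ∀ θ, g θ ≠ 0) :
    SubtractionFree x fun θ => f θ / g θ := by
  obtain ⟨e, he⟩ := hf
  obtain ⟨e', he'⟩ := hg
  exact ⟨.div e e', fun θ => ⟨⟨(he θ).1, (he' θ).1, by rw [(he' θ).2]; exact h θ⟩,
    by rw [Expr.eval, (he θ).2, (he' θ).2]⟩⟩

theorem sum {ι : Type*} (s : Finset ι) {f : ι → Θ → ℝ} (hf : ∀ i ∈ s, SubtractionFree x (f i))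
    (h0 : ∀ i ∈ s, ∀ θ, 0 ≤ f i θ) : SubtractionFree x fun θ => ∑ i ∈ s, f i θ := by
  classical
  induction s using Finset.induction_on with
  | empty => simpa using zero
  | insert a s ha ih =>
    simp only [Finset.sum_insert ha]
    exact add (hf a (Finset.mem_insert_self a s))
      (ih (fun i hi => hf i (Finset.mem_insert_of_mem hi))
        fun i hi => h0 i (Finset.mem_insert_of_mem hi))
      (h0 a (Finset.mem_insert_self a s))
      fun θ => Finset.sum_nonneg fun i hi => h0 i (Finset.mem_insert_of_mem hi) θ

theorem dotProduct {ι : Type*} [Fintype ι] {f g : Θ → ι → ℝ}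
    (hf : ∀ i, SubtractionFree x fun θ => f θ i) (hg : ∀ i, SubtractionFree x fun θ => g θ i)
    (f0 : ∀ θ i, 0 ≤ f θ i) (g0 : ∀ θ i, 0 ≤ g θ i) :
    SubtractionFree x fun θ => f θ ⬝ᵥ g θ :=
  sum Finset.univ (fun i _ => (hf i).mul (hg i)) fun i _ θ => mul_nonneg (f0 θ i) (g0 θ i)

theorem congr (hf : SubtractionFree x f) (h : ∀ θ, f θ = g θ) : SubtractionFree x g :=
  funext h ▸ hf

end SubtractionFree

theorem IsMMatrix.diag_pos {n : Type*} [Fintype n] {X : Matrix n n ℝ} (hX : IsMMatrix X) (i : n) :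
    0 < X i i := by
  classical
  by_contra h
  have := hX.eq_zero (Pi.single i 1) (Pi.single_nonneg.2 zero_le_one) (fun j => by
    rw [mulVec_single_one]
    by_cases hij : j = i
    · rw [hij]; exact not_lt.1 h
    · exact hX.offdiag j i hij)
  simpa using congrFun this i

/-- Gaussian elimination for M-matrices that are represented by their off-diagonal entries, a
positive vector `u`, and `u X`: the pivots are computed from `u X` without subtractions. -/
theorem subtractionFree_solve_fin (n : ℕ) {X : Θ → Matrix (Fin n) (Fin n) ℝ}
    {u b y : Θ → Fin n → ℝ} (hX : ∀ θ, IsMMatrix (X θ)) (hu : ∀ θ i, 0 < u θ i)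
    (hr : ∀ θ i, 0 ≤ (u θ ᵥ* X θ) i) (hb : ∀ θ i, 0 ≤ b θ i) (hy : ∀ θ, X θ *ᵥ y θ = b θ)
    (sX : ∀ i j, i ≠ j → SubtractionFree x fun θ => X θ i j)
    (su : ∀ i, SubtractionFree x fun θ => u θ i)
    (sr : ∀ i, SubtractionFree x fun θ => (u θ ᵥ* X θ) i)
    (sb : ∀ i, SubtractionFree x fun θ => b θ i) (i : Fin n) :
    SubtractionFree x fun θ => y θ i := by
  induction n with
  | zero => exact i.elim0
  | succ n ih =>
    have hp : ∀ θ, 0 < X θ 0 0 := fun θ => (hX θ).diag_pos 0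
    have hcol : ∀ θ (i : Fin n), 0 ≤ -X θ i.succ 0 := fun θ i =>
      neg_nonneg.2 ((hX θ).offdiag _ _ (Fin.succ_ne_zero i))
    have hrow : ∀ θ (i : Fin n), 0 ≤ -X θ 0 i.succ := fun θ i =>
      neg_nonneg.2 ((hX θ).offdiag _ _ (Fin.succ_ne_zero i).symm)
    have scol : ∀ i : Fin n, SubtractionFree x fun θ => -X θ i.succ 0 := fun i =>
      (sX _ _ (Fin.succ_ne_zero i)).neg
    have srow : ∀ i : Fin n, SubtractionFree x fun θ => -X θ 0 i.succ := fun i =>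
      (sX _ _ (Fin.succ_ne_zero i).symm).neg
    have hr0 : ∀ θ j, (u θ ᵥ* X θ) j = u θ 0 * X θ 0 j + ∑ i : Fin n, u θ i.succ * X θ i.succ j :=
      fun θ j => Fin.sum_univ_succ _
    have hy0 : ∀ θ j, X θ j 0 * y θ 0 + ∑ i : Fin n, X θ j i.succ * y θ i.succ = b θ j :=
      fun θ j => (Fin.sum_univ_succ _).symm.trans (congrFun (hy θ) j)
    -- The pivot comes from column `0` of `u X`: `u₀ X₀₀ = (u X)₀ + ∑ uᵢ (-Xᵢ₀)`.
    have sp : SubtractionFree x fun θ => X θ 0 0 := by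
      refine (((sr 0).add (.dotProduct (f := fun θ (i : Fin n) => u θ i.succ)
        (g := fun θ (i : Fin n) => -X θ i.succ 0) (fun i => su i.succ) scol
        (fun θ i => (hu θ _).le) hcol) (hr · 0) fun θ => ?_).div (su 0)
        fun θ => (hu θ 0).ne').congr fun θ => ?_
      · exact Finset.sum_nonneg fun i _ => mul_nonneg (hu θ _).le (hcol θ i)
      · rw [div_eq_iff (hu θ 0).ne', hr0]
        simp only [_root_.dotProduct, mul_neg, Finset.sum_neg_distrib]
        ring
    set X' : Θ → Matrix (Fin n) (Fin n) ℝ := fun θ => Matrix.of fun i j =>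
      X θ i.succ j.succ - X θ i.succ 0 / X θ 0 0 * X θ 0 j.succ with hX'
    have hX'y : ∀ θ (z : Fin n → ℝ) i, (X' θ *ᵥ z) i =
        X θ i.succ 0 * (-(∑ j : Fin n, X θ 0 j.succ * z j) / X θ 0 0) +
          ∑ j : Fin n, X θ i.succ j.succ * z j := by
      intro θ z i
      simp only [hX', mulVec, _root_.dotProduct, of_apply, sub_mul, Finset.sum_sub_distrib,
        mul_assoc, ← Finset.mul_sum]
      ring
    -- The Schur complement inherits the representation: the restricted `u` times `X'` is a sum of
    -- nonnegative terms in the old data.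
    have hr' : ∀ θ j, (u θ ∘ Fin.succ ᵥ* X' θ) j =
        (u θ ᵥ* X θ) j.succ + (u θ ᵥ* X θ) 0 / X θ 0 0 * -X θ 0 j.succ := by
      intro θ j
      have hp' := (hp θ).ne'
      have e : (u θ ∘ Fin.succ ᵥ* X' θ) j = ∑ i : Fin n, u θ i.succ * X θ i.succ j.succ -
          (∑ i : Fin n, u θ i.succ * X θ i.succ 0) / X θ 0 0 * X θ 0 j.succ := by
        simp only [hX', vecMul, _root_.dotProduct, of_apply, mul_sub, Finset.sum_sub_distrib,
          Function.comp, Finset.sum_div, Finset.sum_mul]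
        congr 1
        exact Finset.sum_congr rfl fun i _ => by ring
      rw [e, hr0, hr0]
      field_simp
      ring
    have hM : ∀ θ, IsMMatrix (X' θ) := by
      refine fun θ => ⟨fun i j hij => ?_, fun z hz hXz => ?_⟩
      · have h1 := (hX θ).offdiag i.succ j.succ (by simpa using hij)
        have h2 := mul_nonneg (div_nonneg (hcol θ i) (hp θ).le) (hrow θ j)
        simp only [hX', of_apply]
        rw [neg_div] at h2
        linarith
      -- The test vector is extended by the entry that makes row `0` of the product vanish.
      · have hz0 : 0 ≤ -(∑ j : Fin n, X θ 0 j.succ * z j) / X θ 0 0 := by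
          refine div_nonneg ?_ (hp θ).le
          rw [← Finset.sum_neg_distrib]
          refine Finset.sum_nonneg fun j _ => ?_
          rw [← neg_mul]
          exact mul_nonneg (hrow θ j) (hz j)
        have := (hX θ).eq_zero
          (Fin.cons (-(∑ j : Fin n, X θ 0 j.succ * z j) / X θ 0 0) z)
          (fun i => by
            refine Fin.cases ?_ (fun i => ?_) i
            · simpa using hz0
            · simpa using hz i)
          (fun i => by
            have e : ∀ i, (X θ *ᵥ Fin.cons (α := fun _ => ℝ)
                (-(∑ j : Fin n, X θ 0 j.succ * z j) / X θ 0 0) z) i =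
                X θ i 0 * (-(∑ j : Fin n, X θ 0 j.succ * z j) / X θ 0 0) +
                  ∑ j : Fin n, X θ i j.succ * z j := fun i => by
              simp [mulVec, _root_.dotProduct, Fin.sum_univ_succ]
            rw [e]
            refine Fin.cases ?_ (fun i => ?_) i
            · have hp' := (hp θ).ne'
              rw [mul_div_cancel₀ _ hp']
              simp
            · rw [← hX'y]; exact hXz i)
        funext i
        simpa using congrFun this i.succ
    have ynn : ∀ θ i, 0 ≤ y θ i := fun θ => (hX θ).nonneg_of_mulVec (by rw [hy]; exact hb θ)
    have sy : ∀ i : Fin n, SubtractionFree x fun θ => y θ i.succ := by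
      refine ih (X := X') (u := fun θ => u θ ∘ Fin.succ) (y := fun θ i => y θ i.succ)
        (b := fun θ i => b θ i.succ + -X θ i.succ 0 * (b θ 0 / X θ 0 0)) hM
        (fun θ i => hu θ _) (fun θ i => ?_) (fun θ i => ?_) (fun θ => ?_) (fun i j hij => ?_)
        (fun i => su _) (fun i => ?_) fun i => ?_
      · rw [hr']
        exact add_nonneg (hr θ _) (mul_nonneg (div_nonneg (hr θ 0) (hp θ).le) (hrow θ i))
      · exact add_nonneg (hb θ _) (mul_nonneg (hcol θ i) (div_nonneg (hb θ 0) (hp θ).le))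
      · funext i
        have hp' := (hp θ).ne'
        rw [hX'y, ← hy0 θ i.succ, ← hy0 θ 0]
        field_simp
        ring
      -- An off-diagonal entry of `X'` is minus a sum of two nonnegative terms.
      · refine ((sX i.succ j.succ (by simpa using hij)).neg.add
          (((scol i).div sp fun θ => (hp θ).ne').mul (srow j)) (fun θ => ?_)
          fun θ => ?_).neg.congr fun θ => ?_
        · exact neg_nonneg.2 ((hX θ).offdiag _ _ (by simpa using hij))
        · exact mul_nonneg (div_nonneg (hcol θ i) (hp θ).le) (hrow θ j)
        · simp only [hX', of_apply]; ring
      · refine ((sr i.succ).add (((sr 0).div sp fun θ => (hp θ).ne').mul (srow i)) (hr · _)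
          fun θ => ?_).congr fun θ => (hr' θ i).symm
        exact mul_nonneg (div_nonneg (hr θ 0) (hp θ).le) (hrow θ i)
      · exact (sb i.succ).add ((scol i).mul ((sb 0).div sp fun θ => (hp θ).ne')) (hb · _)
          fun θ => mul_nonneg (hcol θ i) (div_nonneg (hb θ 0) (hp θ).le)
    refine Fin.cases ?_ sy i
    refine (((sb 0).add (.dotProduct (f := fun θ (i : Fin n) => -X θ 0 i.succ)
        (g := fun θ (i : Fin n) => y θ i.succ) srow sy hrow fun θ i => ynn θ _) (hb · 0)
        fun θ => ?_).div sp fun θ => (hp θ).ne').congr fun θ => ?_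
    · exact Finset.sum_nonneg fun i _ => mul_nonneg (hrow θ i) (ynn θ _)
    · rw [div_eq_iff (hp θ).ne', ← hy0 θ 0]
      simp only [_root_.dotProduct, neg_mul, Finset.sum_neg_distrib]
      ring

/-- The inverse of an M-matrix is computed without subtractions from its off-diagonal entries, a
positive vector `u`, and `u X`. -/
theorem subtractionFree_inv {n : Type*} [Fintype n] [DecidableEq n] {X : Θ → Matrix n n ℝ}
    {u : Θ → n → ℝ} (hX : ∀ θ, IsMMatrix (X θ)) (hu : ∀ θ i, 0 < u θ i)
    (hr : ∀ θ i, 0 ≤ (u θ ᵥ* X θ) i)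
    (sX : ∀ i j, i ≠ j → SubtractionFree x fun θ => X θ i j)
    (su : ∀ i, SubtractionFree x fun θ => u θ i)
    (sr : ∀ i, SubtractionFree x fun θ => (u θ ᵥ* X θ) i) (i j : n) :
    SubtractionFree x fun θ => (X θ)⁻¹ i j := by
  let e := Fintype.equivFin n
  have hvec : ∀ θ l, ((u θ ∘ e.symm) ᵥ* (X θ).submatrix e.symm e.symm) l =
      (u θ ᵥ* X θ) (e.symm l) := fun θ l =>
    e.symm.sum_comp fun a => u θ a * X θ a (e.symm l)
  have hmul : ∀ θ (z : n → ℝ) l, ((X θ).submatrix e.symm e.symm *ᵥ (z ∘ e.symm)) l =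
      (X θ *ᵥ z) (e.symm l) := fun θ z l =>
    e.symm.sum_comp fun a => X θ (e.symm l) a * z a
  have hM : ∀ θ, IsMMatrix ((X θ).submatrix e.symm e.symm) := by
    refine fun θ => ⟨fun a b hab => (hX θ).offdiag _ _ (by simpa using hab), fun z hz h => ?_⟩
    have hze : z = (z ∘ e) ∘ e.symm := by funext l; simp
    have := (hX θ).eq_zero (z ∘ e) (fun l => hz _) fun l => by
      have := h (e l)
      rw [hze, hmul] at this
      simpa using this
    rw [hze, this]
    rfl
  have := subtractionFree_solve_fin (x := x) (Fintype.card n)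
    (X := fun θ => (X θ).submatrix e.symm e.symm) (u := fun θ => u θ ∘ e.symm)
    (b := fun _ => Pi.single j 1 ∘ e.symm) (y := fun θ => (fun l => (X θ)⁻¹ l j) ∘ e.symm)
    hM (fun θ l => hu θ _) (fun θ l => by rw [hvec]; exact hr θ _)
    (fun θ l => by
      have : (0 : n → ℝ) ≤ Pi.single j 1 := Pi.single_nonneg.2 zero_le_one
      exact this _)
    (fun θ => by
      funext l
      rw [hmul]
      have : X θ *ᵥ (fun l => (X θ)⁻¹ l j) = Pi.single j 1 := by
        have h1 : (fun l => (X θ)⁻¹ l j) = (X θ)⁻¹ *ᵥ Pi.single j 1 := by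
          rw [mulVec_single_one]; rfl
        rw [h1, mulVec_mulVec, mul_nonsing_inv _ (hX θ).isUnit_det, one_mulVec]
      rw [this]
      rfl)
    (fun a b hab => sX _ _ (by simpa using hab)) (fun a => su _)
    (fun a => by simp only [hvec]; exact sr _)
    (fun a => by
      by_cases h : e.symm a = j
      · simpa [h] using SubtractionFree.one
      · simpa [h] using SubtractionFree.zero)
    (e i)
  simpa using this

end SubtractionFree

/-! ### Triplet representations and subtraction-free expressions -/

section Triplet

variable {m k : Type*} [Fintype m] [Fintype k]

/-- The data from which the pairs are computed, with the properties that make the computation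
subtraction-free. -/
structure TripletData (m k : Type*) [Fintype m] [Fintype k] where
  B : Matrix (m ⊕ k) (m ⊕ k) ℝ
  C : Matrix (m ⊕ k) (m ⊕ k) ℝ
  u : m ⊕ k → ℝ
  vhat : m ⊕ k → ℝ
  h : ℝ
  isMMatrix : IsMMatrix B
  C_nonneg : ∀ i j, 0 ≤ C i j
  C₁₂ : C.toBlocks₁₂ = 0
  C₂₂ : C.toBlocks₂₂ = 0
  u_pos : ∀ i, 0 < u i
  vhat_nonneg : ∀ i, 0 ≤ vhat i
  vecMul_B : u ᵥ* B = u ᵥ* C + vhat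
  h_pos : 0 < h

namespace TripletData

/-- The values of the variables of the expressions. -/
def val (θ : TripletData m k) : Datum (m ⊕ k) → ℝ := Datum.value θ.B θ.C θ.u θ.vhat θ.h

theorem offdiagB {i j : m ⊕ k} (hij : i ≠ j) :
    SubtractionFree val fun θ : TripletData m k => θ.B i j := .var (Datum.offdiagB i j hij)

theorem entryC (i j : m ⊕ k) : SubtractionFree val fun θ : TripletData m k => θ.C i j :=
  .var (Datum.entryC i j)

theorem perron (i : m ⊕ k) : SubtractionFree val fun θ : TripletData m k => θ.u i :=
  .var (Datum.perron i)

theorem limit (i : m ⊕ k) : SubtractionFree val fun θ : TripletData m k => θ.vhat i :=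
  .var (Datum.limit i)

theorem step : SubtractionFree val fun θ : TripletData m k => θ.h := .var Datum.step

variable (θ : TripletData m k)

/-- The restriction of `u` to the first block. -/
def u₁ : m → ℝ := fun i => θ.u (Sum.inl i)

/-- The restriction of `u` to the second block. -/
def u₂ : k → ℝ := fun i => θ.u (Sum.inr i)

/-- The restriction of `vhat` to the first block. -/
def v₁ : m → ℝ := fun i => θ.vhat (Sum.inl i)

/-- The restriction of `vhat` to the second block. -/
def v₂ : k → ℝ := fun i => θ.vhat (Sum.inr i)

theorem negB₁₂_nonneg (i : m) (j : k) : 0 ≤ (-θ.B.toBlocks₁₂) i j :=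
  neg_nonneg.2 (θ.isMMatrix.toBlocks₁₂_nonpos i j)

theorem negB₂₁_nonneg (i : k) (j : m) : 0 ≤ (-θ.B.toBlocks₂₁) i j :=
  neg_nonneg.2 (θ.isMMatrix.toBlocks₂₁_nonpos i j)

theorem u₁_nonneg : 0 ≤ θ.u₁ := fun _ => (θ.u_pos _).le

theorem u₂_nonneg : 0 ≤ θ.u₂ := fun _ => (θ.u_pos _).le

theorem v₁_nonneg : 0 ≤ θ.v₁ := fun _ => θ.vhat_nonneg _

theorem v₂_nonneg : 0 ≤ θ.v₂ := fun _ => θ.vhat_nonneg _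

theorem vecMul_fst : θ.u₁ ᵥ* θ.B.toBlocks₁₁ + θ.u₂ ᵥ* θ.B.toBlocks₂₁ =
    θ.u₁ ᵥ* θ.C.toBlocks₁₁ + θ.u₂ ᵥ* θ.C.toBlocks₂₁ + θ.v₁ := by
  funext j
  have := congrFun θ.vecMul_B (Sum.inl j)
  simp only [vecMul, dotProduct, Fintype.sum_sum_type, Pi.add_apply] at this
  exact this

/-- The second block column of `C` is zero, so only `v̂` remains; the right side is the nonnegative
vector needed for eliminating in `B₂₂`. -/
theorem vecMul_snd : θ.u₂ ᵥ* θ.B.toBlocks₂₂ = θ.v₂ + θ.u₁ ᵥ* -θ.B.toBlocks₁₂ := by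
  funext j
  have := congrFun θ.vecMul_B (Sum.inr j)
  have h1 : ∀ i, θ.C (Sum.inl i) (Sum.inr j) = 0 := fun i => congrFun (congrFun θ.C₁₂ i) j
  have h2 : ∀ i, θ.C (Sum.inr i) (Sum.inr j) = 0 := fun i => congrFun (congrFun θ.C₂₂ i) j
  simp only [vecMul, dotProduct, Fintype.sum_sum_type, Pi.add_apply, h1, h2, mul_zero,
    Finset.sum_const_zero, add_zero, zero_add] at this
  simp only [vecMul, dotProduct, Pi.add_apply, Matrix.neg_apply, mul_neg, Finset.sum_neg_distrib]
  simp only [u₁, u₂, v₂, toBlocks₁₂, toBlocks₂₂, of_apply]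
  linarith

variable [DecidableEq k]

/-- The vector `u₂ - u₁ Ψ`, in a form that involves no subtractions. -/
def excess : k → ℝ := θ.v₂ ᵥ* θ.B.toBlocks₂₂⁻¹

theorem excess_nonneg : 0 ≤ θ.excess :=
  vecMul_nonneg θ.isMMatrix.isMMatrix_toBlocks₂₂.inv_nonneg θ.v₂_nonneg

theorem excess_mul_nonneg : 0 ≤ θ.excess ᵥ* (θ.C.toBlocks₂₁ + -θ.B.toBlocks₂₁) :=
  vecMul_nonneg (fun i j => add_nonneg (θ.C_nonneg _ _) (θ.negB₂₁_nonneg i j)) θ.excess_nonneg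

theorem vecMul_psi : θ.u₁ ᵥ* psi θ.B = θ.u₂ - θ.excess := by
  have h1 := congrArg (· ᵥ* θ.B.toBlocks₂₂⁻¹) θ.vecMul_snd
  simp only [vecMul_vecMul, add_vecMul,
    mul_nonsing_inv _ θ.isMMatrix.isMMatrix_toBlocks₂₂.isUnit_det, vecMul_one] at h1
  rw [psi, h1, excess, add_sub_cancel_left]

/-- Supplies the third part of the triplet for `S`: substituting `u₁ Ψ = u₂ - excess` leaves only
nonnegative summands. -/
theorem vecMul_schur : θ.u₁ ᵥ* schur θ.B =
    (θ.u₁ ᵥ* θ.C.toBlocks₁₁ + θ.u₂ ᵥ* θ.C.toBlocks₂₁ + θ.v₁) +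
      θ.excess ᵥ* -θ.B.toBlocks₂₁ := by
  rw [← θ.vecMul_fst, schur, vecMul_add, ← vecMul_vecMul, θ.vecMul_psi, sub_vecMul, vecMul_neg]
  abel

theorem subtractionFree_inv_B₂₂ (i j : k) :
    SubtractionFree val fun θ : TripletData m k => θ.B.toBlocks₂₂⁻¹ i j := by
  refine subtractionFree_inv (u := fun θ : TripletData m k => θ.u₂)
    (fun θ => θ.isMMatrix.isMMatrix_toBlocks₂₂) (fun θ i => θ.u_pos _) (fun θ i => ?_)
    (fun i j hij => offdiagB (by simpa using hij)) (fun i => perron _) (fun i => ?_) i j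
  · rw [θ.vecMul_snd]
    exact add_nonneg (θ.v₂_nonneg i) (vecMul_nonneg θ.negB₁₂_nonneg θ.u₁_nonneg i)
  · simp only [vecMul_snd, Pi.add_apply]
    exact (limit _).add (.dotProduct (fun i => perron _) (fun i => (offdiagB Sum.inl_ne_inr).neg)
      (fun θ => θ.u₁_nonneg) fun θ j => θ.negB₁₂_nonneg _ _) (fun θ => θ.v₂_nonneg i)
      fun θ => vecMul_nonneg θ.negB₁₂_nonneg θ.u₁_nonneg i

theorem subtractionFree_psi (i : m) (j : k) :
    SubtractionFree val fun θ : TripletData m k => psi θ.B i j :=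
  .dotProduct (f := fun θ : TripletData m k => fun l => (-θ.B.toBlocks₁₂) i l)
    (g := fun θ : TripletData m k => fun l => θ.B.toBlocks₂₂⁻¹ l j)
    (fun _ => (offdiagB Sum.inl_ne_inr).neg) (fun l => subtractionFree_inv_B₂₂ l j)
    (fun θ l => θ.negB₁₂_nonneg i l)
    fun θ l => θ.isMMatrix.isMMatrix_toBlocks₂₂.inv_nonneg l j

theorem subtractionFree_excess (j : k) :
    SubtractionFree val fun θ : TripletData m k => θ.excess j :=
  .dotProduct (f := fun θ : TripletData m k => θ.v₂)
    (g := fun θ : TripletData m k => fun l => θ.B.toBlocks₂₂⁻¹ l j)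
    (fun _ => limit _) (fun l => subtractionFree_inv_B₂₂ l j) (fun θ => θ.v₂_nonneg)
    fun θ l => θ.isMMatrix.isMMatrix_toBlocks₂₂.inv_nonneg l j

variable [DecidableEq m]

theorem subtractionFree_inv_schur (i j : m) :
    SubtractionFree val fun θ : TripletData m k => (schur θ.B)⁻¹ i j := by
  have hC : ∀ θ : TripletData m k,
      0 ≤ θ.u₁ ᵥ* θ.C.toBlocks₁₁ ∧ 0 ≤ θ.u₂ ᵥ* θ.C.toBlocks₂₁ := fun θ =>
    ⟨vecMul_nonneg (fun i j => θ.C_nonneg _ _) θ.u₁_nonneg,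
      vecMul_nonneg (fun i j => θ.C_nonneg _ _) θ.u₂_nonneg⟩
  have hE : ∀ θ : TripletData m k, 0 ≤ θ.excess ᵥ* -θ.B.toBlocks₂₁ := fun θ =>
    vecMul_nonneg θ.negB₂₁_nonneg θ.excess_nonneg
  have hR : ∀ θ : TripletData m k,
      0 ≤ θ.u₁ ᵥ* θ.C.toBlocks₁₁ + θ.u₂ ᵥ* θ.C.toBlocks₂₁ + θ.v₁ := fun θ =>
    add_nonneg (add_nonneg (hC θ).1 (hC θ).2) θ.v₁_nonneg
  refine subtractionFree_inv (u := fun θ : TripletData m k => θ.u₁)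
    (fun θ => θ.isMMatrix.isMMatrix_schur) (fun θ i => θ.u_pos _) (fun θ i => ?_)
    (fun i j hij => ?_) (fun i => perron _) (fun i => ?_) i j
  · rw [θ.vecMul_schur]
    exact add_nonneg (hR θ i) (hE θ i)
  · have hij' : (Sum.inl i : m ⊕ k) ≠ Sum.inl j := by simpa using hij
    refine ((offdiagB hij').neg.add (.dotProduct
      (f := fun θ : TripletData m k => fun l => psi θ.B i l)
      (g := fun θ : TripletData m k => fun l => (-θ.B.toBlocks₂₁) l j)
      (fun l => subtractionFree_psi i l) (fun l => (offdiagB Sum.inr_ne_inl).neg)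
      (fun θ l => θ.isMMatrix.psi_nonneg i l) fun θ l => θ.negB₂₁_nonneg l j)
      (fun θ => neg_nonneg.2 (θ.isMMatrix.offdiag _ _ hij')) fun θ => ?_).neg.congr fun θ => ?_
    · exact Finset.sum_nonneg fun l _ =>
        mul_nonneg (θ.isMMatrix.psi_nonneg i l) (θ.negB₂₁_nonneg l j)
    · simp only [dotProduct, Matrix.neg_apply, mul_neg, Finset.sum_neg_distrib, neg_add, neg_neg]
      rfl
  · simp only [vecMul_schur, Pi.add_apply]
    refine ((SubtractionFree.add ?_ ?_ (fun θ => (hC θ).1 i) fun θ => (hC θ).2 i).add (limit _)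
      (fun θ => add_nonneg ((hC θ).1 i) ((hC θ).2 i)) fun θ => θ.v₁_nonneg i).add ?_
      (fun θ => hR θ i) fun θ => hE θ i
    · exact .dotProduct (fun l => perron _) (fun l => entryC _ _) (fun θ => θ.u₁_nonneg)
        fun θ l => θ.C_nonneg _ _
    · exact .dotProduct (fun l => perron _) (fun l => entryC _ _) (fun θ => θ.u₂_nonneg)
        fun θ l => θ.C_nonneg _ _
    · exact .dotProduct (fun l => subtractionFree_excess l)
        (fun _ => (offdiagB Sum.inr_ne_inl).neg) (fun θ => θ.excess_nonneg)
        fun θ l => θ.negB₂₁_nonneg l i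

theorem subtractionFree_pairY (i j : m) :
    SubtractionFree val fun θ : TripletData m k => pairY θ.C θ.B i j := by
  have h0 : ∀ (θ : TripletData m k) l, 0 ≤ (psi θ.B * θ.C.toBlocks₂₁) i l := fun θ l =>
    mul_entry_nonneg θ.isMMatrix.psi_nonneg (fun i j => θ.C_nonneg _ _) i l
  refine .dotProduct
    (f := fun θ : TripletData m k => fun l => (θ.C.toBlocks₁₁ + psi θ.B * θ.C.toBlocks₂₁) i l)
    (g := fun θ : TripletData m k => fun l => (schur θ.B)⁻¹ l j)
    (fun l => ?_) (fun l => subtractionFree_inv_schur l j)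
    (fun θ l => add_nonneg (θ.C_nonneg _ _) (h0 θ l))
    fun θ l => θ.isMMatrix.isMMatrix_schur.inv_nonneg l j
  exact (entryC _ _).add (.dotProduct (fun a => subtractionFree_psi i a) (fun a => entryC _ _)
    (fun θ a => θ.isMMatrix.psi_nonneg i a) fun θ a => θ.C_nonneg _ _)
    (fun θ => θ.C_nonneg _ _) fun θ => h0 θ l

/-- The vector `u₁ (I - Y)`, in a form that involves no subtractions. -/
def defect : m → ℝ :=
  (θ.v₁ + θ.excess ᵥ* (θ.C.toBlocks₂₁ + -θ.B.toBlocks₂₁)) ᵥ* (schur θ.B)⁻¹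

theorem defect_nonneg : 0 ≤ θ.defect :=
  vecMul_nonneg θ.isMMatrix.isMMatrix_schur.inv_nonneg
    (add_nonneg θ.v₁_nonneg θ.excess_mul_nonneg)

/-- The terms with `C₁₁` cancel in `u₁ S - u₁ (C₁₁ + Ψ C₂₁)`, and those with `C₂₁` combine to
`excess C₂₁`. -/
theorem defect_eq : θ.defect = θ.u₁ - θ.u₁ ᵥ* pairY θ.C θ.B := by
  have hS := θ.isMMatrix.isMMatrix_schur.isUnit_det
  have h1 : θ.u₁ = (θ.u₁ ᵥ* schur θ.B) ᵥ* (schur θ.B)⁻¹ := by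
    rw [vecMul_vecMul, mul_nonsing_inv _ hS, vecMul_one]
  conv_rhs => lhs; rw [h1]
  have h2 : θ.u₁ ᵥ* (psi θ.B * θ.C.toBlocks₂₁) =
      θ.u₂ ᵥ* θ.C.toBlocks₂₁ - θ.excess ᵥ* θ.C.toBlocks₂₁ := by
    rw [← vecMul_vecMul, θ.vecMul_psi, sub_vecMul]
  rw [pairY, ← vecMul_vecMul, ← sub_vecMul, defect, θ.vecMul_schur, vecMul_add _ (psi θ.B * _), h2,
    vecMul_add]
  congr 1
  abel

theorem subtractionFree_defect (i : m) :
    SubtractionFree val fun θ : TripletData m k => θ.defect i := by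
  refine .dotProduct
    (f := fun θ : TripletData m k => θ.v₁ + θ.excess ᵥ* (θ.C.toBlocks₂₁ + -θ.B.toBlocks₂₁))
    (g := fun θ : TripletData m k => fun l => (schur θ.B)⁻¹ l i)
    (fun l => ?_) (fun l => subtractionFree_inv_schur l i)
    (fun θ => add_nonneg θ.v₁_nonneg θ.excess_mul_nonneg)
    fun θ l => θ.isMMatrix.isMMatrix_schur.inv_nonneg l i
  refine (limit _).add (.dotProduct (fun a => subtractionFree_excess a) (fun a => ?_)
    (fun θ => θ.excess_nonneg) fun θ a => ?_) (fun θ => θ.v₁_nonneg l)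
    fun θ => θ.excess_mul_nonneg l
  · exact (entryC _ _).add (offdiagB Sum.inr_ne_inl).neg (fun θ => θ.C_nonneg _ _)
      fun θ => θ.negB₂₁_nonneg _ _
  · exact add_nonneg (θ.C_nonneg _ _) (θ.negB₂₁_nonneg _ _)

/-- Only the diagonal of `Y - I` threatens cancellation; it is obtained from `uᵢ (1 - Yᵢᵢ) = defectᵢ
+ ∑ uₗ Yₗᵢ` over `l ≠ i`. -/
theorem subtractionFree_pairX (i j : m) :
    SubtractionFree val fun θ : TripletData m k => pairX θ.C θ.B θ.h i j := by
  have hY : ∀ (θ : TripletData m k) a b, 0 ≤ pairY θ.C θ.B a b := fun θ =>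
    pairY_nonneg θ.isMMatrix θ.C_nonneg
  by_cases hij : i = j
  · subst hij
    refine ((((subtractionFree_defect i).add (.sum (Finset.univ.erase i)
      (f := fun l (θ : TripletData m k) => θ.u₁ l * pairY θ.C θ.B l i)
      (fun l _ => (perron _).mul (subtractionFree_pairY l i))
      fun l _ θ => mul_nonneg (θ.u₁_nonneg l) (hY θ l i)) (fun θ => θ.defect_nonneg i)
      fun θ => Finset.sum_nonneg fun l _ => mul_nonneg (θ.u₁_nonneg l) (hY θ l i)).div
      (perron (Sum.inl i)) fun θ => (θ.u_pos _).ne').neg.div step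
      fun θ => θ.h_pos.ne').congr fun θ => ?_
    have h1 : (θ.u₁ ᵥ* pairY θ.C θ.B) i = θ.u₁ i * pairY θ.C θ.B i i +
        ∑ l ∈ Finset.univ.erase i, θ.u₁ l * pairY θ.C θ.B l i :=
      (Finset.add_sum_erase _ _ (Finset.mem_univ i)).symm
    have h2 : θ.u (Sum.inl i) = θ.u₁ i := rfl
    have h3 : θ.u₁ i ≠ 0 := (θ.u_pos _).ne'
    have h4 := θ.h_pos.ne'
    rw [θ.defect_eq, Pi.sub_apply, h1, h2]
    simp only [pairX, Matrix.smul_apply, Matrix.sub_apply, one_apply_eq, smul_eq_mul]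
    field_simp
    ring
  · refine ((subtractionFree_pairY i j).div step fun θ => θ.h_pos.ne').congr fun θ => ?_
    simp [pairX, hij, div_eq_inv_mul]

end TripletData

end Triplet

end MMBM

end

theorem mainTheorem3 {m k : Type*} [Fintype m] [Fintype k] [DecidableEq m] [DecidableEq k] :
    ∃ (EΨ : Matrix m k (MMBM.Expr (MMBM.Datum (m ⊕ k))))
      (EY EX : Matrix m m (MMBM.Expr (MMBM.Datum (m ⊕ k)))),
    ∀ (v d : m ⊕ k → ℝ) (Q : Matrix (m ⊕ k) (m ⊕ k) ℝ) (u : m ⊕ k → ℝ) (h : ℝ),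
      MMBM.IsModel v d Q →
      -- the right summand `k` of the index set is `E₃`
      (∀ i : m ⊕ k, (v i = 0 ∧ d i < 0) ↔ i.isRight = true) →
      -- `u` is the left Perron vector of `Q`
      (∀ i, 0 < u i) → u ᵥ* Q = 0 →
      -- the step `h` is small enough
      0 < h →
      (∀ i : m, 0 ≤ (h ^ 2)⁻¹ * v (Sum.inl i) + h⁻¹ * d (Sum.inl i) + Q (Sum.inl i) (Sum.inl i)) →
      -- Cyclic Reduction does not break down, and `B̂ₙ`, `u Aₙ` converge
      (∀ n, IsUnit (MMBM.cr (MMBM.tildeA v d h) (MMBM.tildeB v d Q h)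
        (MMBM.tildeC v d Q h) n).B.det) ∧
      ∃ (B : Matrix (m ⊕ k) (m ⊕ k) ℝ) (vhat : m ⊕ k → ℝ),
        Tendsto (fun n => (MMBM.cr (MMBM.tildeA v d h) (MMBM.tildeB v d Q h)
          (MMBM.tildeC v d Q h) n).Bhat) atTop (𝓝 B) ∧
        Tendsto (fun n => u ᵥ* (MMBM.cr (MMBM.tildeA v d h) (MMBM.tildeB v d Q h)
          (MMBM.tildeC v d Q h) n).A) atTop (𝓝 vhat) ∧
        -- the inverses in the formulas exist, and the signs are as claimed
        IsUnit B.toBlocks₂₂.det ∧ IsUnit (MMBM.schur B).det ∧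
        (∀ i j, 0 ≤ MMBM.psi B i j) ∧
        (∀ i j, 0 ≤ MMBM.pairY (MMBM.tildeC v d Q h) B i j) ∧
        -- the two stable left invariant pairs
        MMBM.IsDStablePairDeflating (Fintype.card k)
          (MMBM.tildeA v d h) (MMBM.tildeB v d Q h) (MMBM.tildeC v d Q h)
          (MMBM.pairY (MMBM.tildeC v d Q h) B) (MMBM.pairU B) ∧
        MMBM.IsCStablePair (Matrix.diagonal v) (Matrix.diagonal d) Q
          (MMBM.pairX (MMBM.tildeC v d Q h) B h) (MMBM.pairU B) ∧
        -- they are given by the subtraction-free expressions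
        MMBM.Expr.Computes EΨ
          (MMBM.Datum.value B (MMBM.tildeC v d Q h) u vhat h) (MMBM.psi B) ∧
        MMBM.Expr.Computes EY
          (MMBM.Datum.value B (MMBM.tildeC v d Q h) u vhat h)
          (MMBM.pairY (MMBM.tildeC v d Q h) B) ∧
        MMBM.Expr.Computes EX
          (MMBM.Datum.value B (MMBM.tildeC v d Q h) u vhat h)
          (MMBM.pairX (MMBM.tildeC v d Q h) B h) := by
  -- The expressions are fixed before any data: they serve all `TripletData` of the given sizes.
  choose EΨ hΨ using MMBM.TripletData.subtractionFree_psi (m := m) (k := k)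
  choose EY hY using MMBM.TripletData.subtractionFree_pairY (m := m) (k := k)
  choose EX hX using MMBM.TripletData.subtractionFree_pairX (m := m) (k := k)
  refine ⟨EΨ, EY, EX, fun v d Q u h hM hE hu huQ hh hsmall => ?_⟩
  have D : MMBM.IsData v d Q u h := ⟨hM, hE, hu, huQ, hh, hsmall⟩
  obtain ⟨H, hH, hfix, hlim, hlimA⟩ := D.qbd.cr_tendsto
  have p : MMBM.IsLimit v d Q u h H := ⟨D.qbd, hH, hfix⟩
  -- The limit `H` with `v̂ = u H - u C` is one instance of such data.
  let θ : MMBM.TripletData m k :=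
    { B := H
      C := MMBM.tildeC v d Q h
      u := u
      vhat := u ᵥ* H - u ᵥ* MMBM.tildeC v d Q h
      h := h
      isMMatrix := p.isMMatrix
      C_nonneg := D.qbd.C_nonneg
      C₁₂ := MMBM.tildeC_toBlocks₁₂ v d Q h
      C₂₂ := MMBM.tildeC_toBlocks₂₂ v d Q h
      u_pos := hu
      vhat_nonneg := p.limit_nonneg
      vecMul_B := (add_sub_cancel _ _).symm
      h_pos := hh }
  exact ⟨fun n => (D.qbd.crInvariant n).isUnit_B, H, _, hlim, hlimA,
    p.isMMatrix.isMMatrix_toBlocks₂₂.isUnit_det, p.isMMatrix.isMMatrix_schur.isUnit_det,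
    p.isMMatrix.psi_nonneg, MMBM.pairY_nonneg p.isMMatrix D.qbd.C_nonneg,
    p.isDStablePairDeflating (MMBM.tildeC_toBlocks₁₂ v d Q h) (MMBM.tildeC_toBlocks₂₂ v d Q h),
    p.isCStablePair D, fun i j => hΨ i j θ, fun i j => hY i j θ, fun i j => hX i j θ⟩
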